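/- All logarithms are in base two. Let $m\in\mathbb N$, $\varepsilon\in[-1,1]$, and let $f$ be a randomized function over $[m]\times\mathbb Z\times\mathbb Z$. In the $m$-round online binomial game $G=G_{m,\varepsilon,f}$ the round-$i$ coins $C_i$ ($i\in[m]$) are independent, $C_i$ being the sum of $(m-i+1)^2$ independent $\{-1,1\}$-valued coins that equal $1$ with probability $\frac12(1+\varepsilon)$. Let $S_i=C_1+\dots+C_i$, and let $H_i=f(i,S_{i-1},C_i)$ be the round-$i$ hint (with fresh randomness in each round). For $i\in[m]$ let $O_i=\Pr[S_m\ge 0\mid S_{i-1},H_i]$ and $O_i^-=\Pr[S_m\ge0\mid S_{i-1}]$ (evaluated at the realized values), and let $O_{m+1}=O_{m+1}^-$ be the indicator of $S_m\ge 0$. A player $B$ is an arbitrary, possibly stateful and randomized, online algorithm that in round $i$ receives $(S_{i-1},H_i)$ and outputs a bit; $I$ is the first round in which it outputs $1$, and $I=m+1$ if there is none. The bias of the game is $\mathrm{bias}(G)=\max_B|\mathbb E[O_I-O_I^-]|$. For a level $\ell\in[m]$ let $D_\ell=C_{m-\ell+1}$ and $\mathrm{rem}(\ell)=\ell^2+(\ell-1)^2+\dots+1^2$.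 Let $\langle\ell,b\rangle$ be the event $S_{m-\ell}=b$, let $\langle\ell,b,h\rangle$ be the event that $S_{m-\ell}=b$ and $H_{m-\ell+1}=h$, and let $f_{-1}$ be the event $S_m=-1$. For $u=\langle\ell,b,h\rangle$ let $u^-=\langle\ell,b\rangle$, $c_u=\Pr[S_m\ge0\mid u^-]$ and $v_u=\Pr[S_m\ge 0\mid u]$. **Lemma.** For all constants $\lambda',\lambda''$ there is a constant $C>0$ such that the following holds for all $m,\varepsilon,f$ as above and every real $\tau\in[1,m]$. Assume that the total number of coins $\mathrm{rem}(m)$ is odd, that $|\varepsilon|<4\sqrt{\log m/\mathrm{rem}(m)}$, and that $\frac{\tau}{\sqrt m}\log^3 m<1$. Let $$S=\Big\{\langle\ell,b\rangle:\ |b+\varepsilon\,\mathrm{rem}(\ell)|\le4\sqrt{\log m\cdot\mathrm{rem}(\ell)},\ \ \ell\ge\max\big(\lfloor m^{1/8}\rfloor,\tau^2\log^3m\big),\ \ b+1\equiv\mathrm{rem}(\ell)\ (\mathrm{mod}\ 2)\Big\}.$$ (i) Suppose that for every $\langle\ell,b\rangle\in S$ there is a set $\mathcal H_{\ell,b}$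 of hints such that 1. $\sum_{h\notin\mathcal H_{\ell,b}}\Pr[\langle\ell,b,h\rangle\mid\langle\ell,b\rangle]\le\frac1{m^2}$, and 2. for every $u=\langle\ell,b,h\rangle$ with $h\in\mathcal H_{\ell,b}$, $$c_u-v_u\le\lambda'\,\tau\sqrt{m\log m}\,\Pr[f_{-1}\mid u^-]\qquad\text{and}\qquad \Pr\big[D_\ell>9\sqrt{\ell^2\log m}\ \big|\ u\big]\le\frac{\lambda''}{m^{12}}.$$ Then $\mathbb E[O_I^--O_I]\le C\cdot\frac{\tau\sqrt{\log m}}{m}$ for every player. (ii) If the sets $\mathcal H_{\ell,b}$ in (i) can be chosen so that moreover $|c_u-v_u|\le\lambda'\,\tau\sqrt{m\log m}\,\Pr[f_{-1}\mid u^-]$ for every $u=\langle\ell,b,h\rangle$ with $\langle\ell,b\rangle\in S$ and $h\in\mathcal H_{\ell,b}$, then $\mathrm{bias}(G)\le C\cdot\frac{\tau\sqrt{\log m}}{m}$. -/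

import Mathlib

open scoped BigOperators

noncomputable section

namespace BinomialGame

/-! ### Elementary discrete probability -/

/-- The probability of the event `E`, as a real number. -/
def prob {α : Type*} (p : PMF α) (E : Set α) : ℝ := (p.toOuterMeasure E).toReal

/-- The conditional probability `Pr[E | F]` (it is `0` when `F` has probability `0`). -/
def condProb {α : Type*} (p : PMF α) (E F : Set α) : ℝ := prob p (E ∩ F) / prob p F

/-- The expectation of `g` under `p`. -/
def expect {α : Type*} (p : PMF α) (g : α → ℝ) : ℝ := ∑' x, (p x).toReal * g x

/-! ### The game -/

/-- The `{-1, 1}`-valued coin that takes the value `1` with probability `(1 + ε) / 2`. -/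
def coin (ε : Set.Icc (-1 : ℝ) 1) : PMF ℤ :=
  (PMF.ofFintype (fun o : Bool => ENNReal.ofReal (if o = true then (1 + ε) / 2 else (1 - ε) / 2))
    (by
      have h1 := ε.2.1
      have h2 := ε.2.2
      rw [Fintype.sum_bool, ← ENNReal.ofReal_add (by simp; linarith) (by simp; linarith)]
      simp only [if_true, Bool.false_eq_true, if_false]
      rw [← ENNReal.ofReal_one]
      congr 1
      ring)).map fun o => if o = true then 1 else -1

/-- The law of the sum of `n` independent coins of bias `ε`. -/
def coinSum (ε : Set.Icc (-1 : ℝ) 1) : ℕ → PMF ℤ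
  | 0 => PMF.pure 0
  | n + 1 => (coinSum ε n).bind fun s => (coin ε).map fun c => s + c

/-- The law of the coins and hints of the first `k` rounds of the `m`-round game, where `f i b c`
is the law of the hint given in round `i` when the previous coins sum to `b` and the coins of
round `i` sum to `c`. Entry `j : Fin k` is the pair `(C_{j+1}, H_{j+1})`; round `i` has
`(m - i + 1) ^ 2` coins, and fresh randomness is used for the coins and the hint of each round. -/
def transcript {H : Type*} (m : ℕ) (ε : Set.Icc (-1 : ℝ) 1) (f : ℕ → ℤ → ℤ → PMF H) :
    (k : ℕ) → PMF (Fin k → ℤ × H)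
  | 0 => PMF.pure Fin.elim0
  | k + 1 => (transcript m ε f k).bind fun ω =>
      (coinSum ε ((m - k) ^ 2)).bind fun c =>
        (f (k + 1) (∑ j, (ω j).1) c).map fun h =>
          Fin.snoc (α := fun _ => ℤ × H) ω (c, h)

/-- The law of a full run of the `m`-round online binomial game with bias `ε` and hint
function `f`. -/
def game {H : Type*} (m : ℕ) (ε : Set.Icc (-1 : ℝ) 1) (f : ℕ → ℤ → ℤ → PMF H) :
    PMF (Fin m → ℤ × H) := transcript m ε f m

/-- `S_k`: the sum of the coins of the first `k` rounds. -/
def partialSum {H : Type*} {m : ℕ} (ω : Fin m → ℤ × H) (k : ℕ) : ℤ :=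
  ∑ j ∈ Finset.univ.filter (fun j : Fin m => (j : ℕ) < k), (ω j).1

/-- The event `S_m ≥ 0`. -/
def finalPos {H : Type*} (m : ℕ) : Set (Fin m → ℤ × H) := {ω | 0 ≤ partialSum ω m}

/-- The final state of offset `b`: the event `S_m = b`. -/
def finalState {H : Type*} (m : ℕ) (b : ℤ) : Set (Fin m → ℤ × H) := {ω | partialSum ω m = b}

/-- The no-hint state: the event that the coins of the rounds before round `j + 1` sum to `b`. -/
def noHint {H : Type*} {m : ℕ} (j : Fin m) (b : ℤ) : Set (Fin m → ℤ × H) :=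
  {ω | partialSum ω j = b}

/-- The with-hint state: the coins of the rounds before round `j + 1` sum to `b`, and the hint
of round `j + 1` is `h`. -/
def withHint {H : Type*} {m : ℕ} (j : Fin m) (b : ℤ) (h : H) : Set (Fin m → ℤ × H) :=
  {ω | partialSum ω j = b ∧ (ω j).2 = h}

/-! ### Players and the bias -/

/-- A (possibly stateful and randomized) online player. Its argument is the list of the inputs
`(S_0, H_1), …, (S_{i-1}, H_i)` received up to the current round `i` (the length of the list); its
value is the law of its output bit, conditioned on not having output `1` in an earlier round. -/
abbrev Player (H : Type*) := List (ℤ × H) → PMF Bool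

/-- The inputs `(S_0, H_1), …, (S_j, H_{j+1})` received in the rounds up to `j + 1`. -/
def history {H : Type*} {m : ℕ} (ω : Fin m → ℤ × H) (j : Fin m) : List (ℤ × H) :=
  (List.ofFn fun i : Fin m => (partialSum ω i, (ω i).2)).take (j + 1)

/-- The law of the first of the listed rounds in which the player outputs `1`
(`none` if there is no such round). -/
def firstOne {H : Type*} {m : ℕ} (B : Player H) (ω : Fin m → ℤ × H) :
    List (Fin m) → PMF (Option (Fin m))
  | [] => PMF.pure none
  | j :: js => (B (history ω j)).bind fun o =>
      if o = true then PMF.pure (some j) else firstOne B ω js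

/-- The joint law of a run of the game and of the round `I` in which the player first outputs `1`;
`some j` stands for `I = j + 1`, and `none` for `I = m + 1`. -/
def play {H : Type*} (m : ℕ) (ε : Set.Icc (-1 : ℝ) 1) (f : ℕ → ℤ → ℤ → PMF H) (B : Player H) :
    PMF ((Fin m → ℤ × H) × Option (Fin m)) :=
  (game m ε f).bind fun ω => (firstOne B ω (List.finRange m)).map fun I => (ω, I)

open Classical in
/-- `O_I`: the probability of `S_m ≥ 0` given the sum of the coins before round `I` and the hint
of round `I`; for `I = m + 1` it is the indicator of `S_m ≥ 0`. -/
def outcome {H : Type*} (m : ℕ) (ε : Set.Icc (-1 : ℝ) 1) (f : ℕ → ℤ → ℤ → PMF H)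
    (ω : Fin m → ℤ × H) : Option (Fin m) → ℝ
  | some j => condProb (game m ε f) (finalPos m) (withHint j (partialSum ω j) (ω j).2)
  | none => if 0 ≤ partialSum ω m then 1 else 0

open Classical in
/-- `O_I⁻`: the probability of `S_m ≥ 0` given only the sum of the coins before round `I`;
for `I = m + 1` it is the indicator of `S_m ≥ 0`. -/
def outcomeMinus {H : Type*} (m : ℕ) (ε : Set.Icc (-1 : ℝ) 1) (f : ℕ → ℤ → ℤ → PMF H)
    (ω : Fin m → ℤ × H) : Option (Fin m) → ℝ
  | some j => condProb (game m ε f) (finalPos m) (noHint j (partialSum ω j))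
  | none => if 0 ≤ partialSum ω m then 1 else 0

/-- The signed gain `E[O_I⁻ - O_I]` of a player. -/
def signedBias {H : Type*} (m : ℕ) (ε : Set.Icc (-1 : ℝ) 1) (f : ℕ → ℤ → ℤ → PMF H)
    (B : Player H) : ℝ :=
  expect (play m ε f B) fun x => outcomeMinus m ε f x.1 x.2 - outcome m ε f x.1 x.2

/-- The bias of a game: the largest value of `|E[O_I - O_I⁻]|` over all players. -/
def bias {H : Type*} (m : ℕ) (ε : Set.Icc (-1 : ℝ) 1) (f : ℕ → ℤ → ℤ → PMF H) : ℝ :=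
  ⨆ B : Player H, |signedBias m ε f B|

theorem condProb_nonneg {α : Type*} (p : PMF α) (E F : Set α) : 0 ≤ condProb p E F :=
  div_nonneg ENNReal.toReal_nonneg ENNReal.toReal_nonneg

theorem condProb_le_one {α : Type*} (p : PMF α) (E F : Set α) : condProb p E F ≤ 1 := by
  refine div_le_one_of_le₀ ?_ ENNReal.toReal_nonneg
  refine ENNReal.toReal_mono ?_ (MeasureTheory.measure_mono Set.inter_subset_right)
  refine ne_top_of_le_ne_top ENNReal.one_ne_top ?_
  calc p.toOuterMeasure F ≤ p.toOuterMeasure Set.univ :=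
        MeasureTheory.measure_mono (Set.subset_univ F)
    _ = 1 := (p.toOuterMeasure_apply_eq_one_iff Set.univ).2 (Set.subset_univ _)

/-- Every player has bias at most `1`. -/
theorem abs_signedBias_le_one {H : Type*} (m : ℕ) (ε : Set.Icc (-1 : ℝ) 1)
    (f : ℕ → ℤ → ℤ → PMF H) (B : Player H) : |signedBias m ε f B| ≤ 1 := by
  have hs : HasSum (fun x => (play m ε f B x).toReal) 1 := by
    have h := ENNReal.hasSum_toReal (f := play m ε f B)
      (by rw [PMF.tsum_coe]; exact ENNReal.one_ne_top)
    rwa [← ENNReal.tsum_toReal_eq (fun x => PMF.apply_ne_top _ x), PMF.tsum_coe,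
      ENNReal.toReal_one] at h
  have := tsum_of_norm_bounded (f := fun x => (play m ε f B x).toReal *
    (outcomeMinus m ε f x.1 x.2 - outcome m ε f x.1 x.2)) hs ?_
  · exact this
  · rintro ⟨ω, I⟩
    rw [norm_mul, Real.norm_eq_abs, Real.norm_eq_abs, abs_of_nonneg ENNReal.toReal_nonneg]
    refine mul_le_of_le_one_right ENNReal.toReal_nonneg ?_
    cases I with
    | none => simp [outcome, outcomeMinus]
    | some j =>
      simp only [outcome, outcomeMinus]
      exact abs_sub_le_of_nonneg_of_le (condProb_nonneg _ _ _) (condProb_le_one _ _ _)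
        (condProb_nonneg _ _ _) (condProb_le_one _ _ _)

/-- The supremum in the definition of `bias` is over a bounded set. -/
theorem bddAbove_bias {H : Type*} (m : ℕ) (ε : Set.Icc (-1 : ℝ) 1) (f : ℕ → ℤ → ℤ → PMF H) :
    BddAbove (Set.range fun B : Player H => |signedBias m ε f B|) :=
  ⟨1, by rintro _ ⟨B, rfl⟩; exact abs_signedBias_le_one m ε f B⟩

/-! ### Levels, typical states and good hint sets -/

/-- The level of round `j + 1` of the `m`-round game: the number of rounds left, this one
included. -/
def level {m : ℕ} (j : Fin m) : ℕ := m - j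

/-- The number `ℓ² + … + 1²` of coins that remain to be tossed at level `ℓ`. In particular
`rem m` is the number of coins of the whole `m`-round game. -/
def rem (ℓ : ℕ) : ℕ := ∑ k ∈ Finset.Icc 1 ℓ, k ^ 2

/-- `c_u = Pr[S_m ≥ 0 | u⁻]`, where `u⁻` is the no-hint state `(j, b)`. -/
def cVal {H : Type*} (m : ℕ) (ε : Set.Icc (-1 : ℝ) 1) (f : ℕ → ℤ → ℤ → PMF H)
    (j : Fin m) (b : ℤ) : ℝ :=
  condProb (game m ε f) (finalPos m) (noHint j b)

/-- `v_u = Pr[S_m ≥ 0 | u]`, where `u` is the with-hint state `(j, b, h)`. -/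
def vVal {H : Type*} (m : ℕ) (ε : Set.Icc (-1 : ℝ) 1) (f : ℕ → ℤ → ℤ → PMF H)
    (j : Fin m) (b : ℤ) (h : H) : ℝ :=
  condProb (game m ε f) (finalPos m) (withHint j b h)

/-- The set `S` of typical no-hint states. -/
def Typical (m : ℕ) (ε : Set.Icc (-1 : ℝ) 1) (τ : ℝ) (j : Fin m) (b : ℤ) : Prop :=
  |(b : ℝ) + ε * rem (level j)| ≤ 4 * √(Real.logb 2 m * rem (level j)) ∧
  max (⌊(m : ℝ) ^ (1 / 8 : ℝ)⌋₊ : ℝ) (τ ^ 2 * Real.logb 2 m ^ 3) ≤ level j ∧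
  b + 1 ≡ rem (level j) [ZMOD 2]

/-- The bound `c' · τ · √(m log m) · Pr[f_{-1} | u⁻]` on the change of value in a state `u` with
no-hint state `u⁻ = (j, b)`. -/
def changeBound {H : Type*} (m : ℕ) (ε : Set.Icc (-1 : ℝ) 1) (f : ℕ → ℤ → ℤ → PMF H)
    (τ c' : ℝ) (j : Fin m) (b : ℤ) : ℝ :=
  c' * τ * √(m * Real.logb 2 m) * condProb (game m ε f) (finalState m (-1)) (noHint j b)

/-- `A` is a good set of hints for the no-hint state `(j, b)`: the other hints have total
probability at most `1 / m²`, and for `h ∈ A` the hint lowers the value by at most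
`changeBound`, and the coins of the round are concentrated given the hint. -/
structure GoodHints {H : Type*} (m : ℕ) (ε : Set.Icc (-1 : ℝ) 1) (f : ℕ → ℤ → ℤ → PMF H)
    (τ c' c'' : ℝ) (j : Fin m) (b : ℤ) (A : Set H) : Prop where
  mass : ∑' h : (Aᶜ : Set H), condProb (game m ε f) (withHint j b (h : H)) (noHint j b)
    ≤ 1 / (m : ℝ) ^ 2
  change : ∀ h ∈ A, cVal m ε f j b - vVal m ε f j b h ≤ changeBound m ε f τ c' j b
  concentrated : ∀ h ∈ A,
    condProb (game m ε f) {ω | 9 * √((level j : ℝ) ^ 2 * Real.logb 2 m) < (ω j).1}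
      (withHint j b h) ≤ c'' / (m : ℝ) ^ 12

end BinomialGame

end

namespace BinomialGame

open scoped ENNReal

/-! In a state `u` where the player stops, the gain is `c - v`. The bound comes from charging the
probable gains to events about the final sum `S_m`. Stopping in different rounds is disjoint, so
charging all rounds to one event costs that event's probability only once
(`sum_eexp_stopProb_mul_le`).

Write `L = log m`. A state whose offset is far from its centre almost determines the sign of `S_m`.
One of the two final events is then improbable, and since `v` averages to `c` over the hints, the
mean gain is tiny (`eexp_unlikelyTerm_le`). For central offsets there are two cases.

At levels below `m^(1/8)` the gain is bounded by 1. So few coins remain that `|S_m| ≤ √m` up to a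
tail (`eexp_stopProb_mul_window_le`). This event has probability `O(√m · m^(-3/2)) = O(1/m)`.

At higher levels the gain is at most `K · Pr[S_m = -1 | u⁻]` with `K = O(τ √(m L))`, up to
exceptional terms. If the level `ℓ` is at least `τ² L³`, this is the hypothesis on the hints.
Otherwise `ℓ ≤ τ √m`, and even full knowledge of the round's coins changes the value by only `O(ℓ
√L) · Pr[S_m = -1 | u⁻]` (`abs_sub_le_of_window`). The hitting probability varies by a bounded
factor over the typical coins of a round (`hitProb_ratio`), so it can be moved past the round in
which the player stops and charged to the event `S_m = -1` (`eexp_stopProb_mul_hitProb_le`). That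
event has probability `O(m^(-3/2))`, which gives `K · m^(-3/2) = O(τ √L / m)`.

Bounded values of `m` are absorbed into the constant, because every gain is at most 1. -/

/-- The expectation of a nonnegative function, as an extended nonnegative real. -/
noncomputable def eexp {α : Type*} (p : PMF α) (g : α → ℝ≥0∞) : ℝ≥0∞ := ∑' x, p x * g x

/-! ### Expectations and conditional probabilities with values in `[0, ∞]`. -/

section Expectation

variable {α β : Type*}

theorem eexp_mono {p : PMF α} {g h : α → ℝ≥0∞} (H : ∀ x, p x ≠ 0 → g x ≤ h x) :
    eexp p g ≤ eexp p h := by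
  refine ENNReal.tsum_le_tsum fun x => ?_
  by_cases hx : p x = 0
  · simp [hx]
  · exact mul_le_mul_right (H x hx) _

theorem eexp_congr {p : PMF α} {g h : α → ℝ≥0∞} (H : ∀ x, p x ≠ 0 → g x = h x) :
    eexp p g = eexp p h :=
  le_antisymm (eexp_mono fun x hx => (H x hx).le) (eexp_mono fun x hx => (H x hx).ge)

theorem eexp_add (p : PMF α) (g h : α → ℝ≥0∞) :
    eexp p (fun x => g x + h x) = eexp p g + eexp p h := by
  simp only [eexp, mul_add, ENNReal.tsum_add]

theorem eexp_const_mul (p : PMF α) (c : ℝ≥0∞) (g : α → ℝ≥0∞) :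
    eexp p (fun x => c * g x) = c * eexp p g := by
  simp only [eexp, ← ENNReal.tsum_mul_left]
  exact tsum_congr fun x => by ring

theorem eexp_mul_const (p : PMF α) (c : ℝ≥0∞) (g : α → ℝ≥0∞) :
    eexp p (fun x => g x * c) = eexp p g * c := by
  simp only [mul_comm _ c, eexp_const_mul]

theorem eexp_const (p : PMF α) (c : ℝ≥0∞) : eexp p (fun _ => c) = c := by
  simp only [eexp, ENNReal.tsum_mul_right, PMF.tsum_coe, one_mul]

theorem eexp_sum {ι : Type*} (p : PMF α) (s : Finset ι) (g : ι → α → ℝ≥0∞) :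
    eexp p (fun x => ∑ i ∈ s, g i x) = ∑ i ∈ s, eexp p (g i) := by
  classical
  induction s using Finset.induction_on with
  | empty => simp [eexp]
  | insert i s hi ih => simp only [Finset.sum_insert hi, eexp_add, ih]

theorem eexp_pure (a : α) (g : α → ℝ≥0∞) : eexp (PMF.pure a) g = g a := by
  classical
  rw [eexp, tsum_eq_single a]
  · simp
  · intro b hb
    simp [hb]

theorem eexp_bind (p : PMF α) (k : α → PMF β) (g : β → ℝ≥0∞) :
    eexp (p.bind k) g = eexp p fun a => eexp (k a) g := by
  simp only [eexp, PMF.bind_apply, ← ENNReal.tsum_mul_right, ← ENNReal.tsum_mul_left]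
  rw [ENNReal.tsum_comm]
  exact tsum_congr fun a => tsum_congr fun b => by ring

theorem eexp_map (p : PMF α) (k : α → β) (g : β → ℝ≥0∞) :
    eexp (p.map k) g = eexp p fun a => g (k a) := by
  rw [← PMF.bind_pure_comp, eexp_bind]
  simp only [Function.comp, eexp_pure]

/-- The probability of `E`, as an extended nonnegative real. -/
noncomputable def pr (p : PMF α) (E : Set α) : ℝ≥0∞ := eexp p (E.indicator 1)

theorem toOuterMeasure_eq_pr (p : PMF α) (E : Set α) : p.toOuterMeasure E = pr p E := by
  rw [PMF.toOuterMeasure_apply, pr, eexp]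
  refine tsum_congr fun x => ?_
  by_cases hx : x ∈ E <;> simp [hx]

theorem prob_eq (p : PMF α) (E : Set α) : prob p E = (pr p E).toReal := by
  rw [prob, toOuterMeasure_eq_pr]

theorem eexp_le_one {p : PMF α} {g : α → ℝ≥0∞} (H : ∀ x, g x ≤ 1) : eexp p g ≤ 1 :=
  (eexp_mono fun x _ => H x).trans (eexp_const p 1).le

theorem indicator_one_le_one (E : Set α) (x : α) : E.indicator (1 : α → ℝ≥0∞) x ≤ 1 :=
  Set.indicator_le_self' (fun _ _ => zero_le) x

theorem pr_le_one (p : PMF α) (E : Set α) : pr p E ≤ 1 :=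
  eexp_le_one (indicator_one_le_one E)

theorem pr_ne_top (p : PMF α) (E : Set α) : pr p E ≠ ∞ :=
  ne_top_of_le_ne_top ENNReal.one_ne_top (pr_le_one p E)

theorem pr_mono (p : PMF α) {E F : Set α} (h : E ⊆ F) : pr p E ≤ pr p F :=
  eexp_mono fun x _ => Set.indicator_le_indicator_of_subset h (fun _ => zero_le) x

theorem pr_add_compl (p : PMF α) (E : Set α) : pr p E + pr p Eᶜ = 1 := by
  rw [pr, pr, ← eexp_add, ← eexp_const p 1]
  refine eexp_congr fun x _ => ?_
  exact congrFun (Set.indicator_self_add_compl E (1 : α → ℝ≥0∞)) x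

theorem pr_union_le (p : PMF α) (E F : Set α) : pr p (E ∪ F) ≤ pr p E + pr p F := by
  rw [pr, pr, pr, ← eexp_add]
  refine eexp_mono fun x _ => ?_
  by_cases h1 : x ∈ E <;> by_cases h2 : x ∈ F <;> simp [h1, h2]

theorem pr_singleton (p : PMF α) (a : α) : pr p {a} = p a := by
  rw [pr, eexp, tsum_eq_single a]
  · simp
  · intro b hb
    simp [hb]

theorem pr_pos_of_mem {p : PMF α} {E : Set α} {x : α} (hx : p x ≠ 0) (hE : x ∈ E) : pr p E ≠ 0 := by
  intro h
  refine hx (le_antisymm ?_ (zero_le))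
  rw [← h, ← pr_singleton]
  exact pr_mono p (Set.singleton_subset_iff.2 hE)

/-- Both sides vanish when `F` is null, so in product form the convention for division by zero is
harmless. -/
theorem ofReal_condProb_mul (p : PMF α) (E F : Set α) :
    ENNReal.ofReal (condProb p E F) * pr p F = pr p (E ∩ F) := by
  by_cases hF : pr p F = 0
  · rw [hF, mul_zero]
    exact (le_antisymm ((pr_mono p Set.inter_subset_right).trans hF.le) (zero_le)).symm
  · have h0 : 0 < (pr p F).toReal := ENNReal.toReal_pos hF (pr_ne_top p F)
    rw [condProb, prob_eq, prob_eq, ENNReal.ofReal_div_of_pos h0,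
      ENNReal.ofReal_toReal (pr_ne_top _ _), ENNReal.ofReal_toReal (pr_ne_top _ _),
      ENNReal.div_mul_cancel hF (pr_ne_top _ _)]

theorem eexp_fiber (p : PMF α) (X : α → β) (y : β) (g : α → ℝ≥0∞) :
    eexp p (fun x => (X ⁻¹' {y}).indicator 1 x * g x) = ∑' x : X ⁻¹' {y}, p x * g x := by
  rw [eexp, tsum_subtype (X ⁻¹' {y}) (fun x => p x * g x)]
  refine tsum_congr fun x => ?_
  by_cases hx : x ∈ X ⁻¹' {y}
  · rw [Set.indicator_of_mem hx, Set.indicator_of_mem hx, Pi.one_apply, one_mul]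
  · rw [Set.indicator_of_notMem hx, Set.indicator_of_notMem hx, zero_mul, mul_zero]

theorem eexp_eq_tsum_fiber (p : PMF α) (X : α → β) (g : α → ℝ≥0∞) :
    eexp p g = ∑' y, eexp p (fun x => (X ⁻¹' {y}).indicator 1 x * g x) := by
  simp only [eexp_fiber]
  exact (ENNReal.tsum_fiberwise (fun x => p x * g x) X).symm

/-- The tower property: averaging `Pr[E | X]` against a function of `X`. -/
theorem eexp_mul_condProb (p : PMF α) (X : α → β) (w : β → ℝ≥0∞) (E : Set α) :
    eexp p (fun x => w (X x) * ENNReal.ofReal (condProb p E (X ⁻¹' {X x}))) =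
      eexp p (fun x => w (X x) * E.indicator 1 x) := by
  rw [eexp_eq_tsum_fiber p X, eexp_eq_tsum_fiber p X]
  refine tsum_congr fun y => ?_
  have h1 : eexp p (fun x => (X ⁻¹' {y}).indicator 1 x *
      (w (X x) * ENNReal.ofReal (condProb p E (X ⁻¹' {X x})))) =
      eexp p (fun x => (w y * ENNReal.ofReal (condProb p E (X ⁻¹' {y}))) *
        (X ⁻¹' {y}).indicator 1 x) := by
    refine eexp_congr fun x _ => ?_
    by_cases hx : X x = y
    · subst hx; simp
    · simp [hx]
  have h2 : eexp p (fun x => (X ⁻¹' {y}).indicator 1 x * (w (X x) * E.indicator 1 x)) =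
      eexp p (fun x => w y * (E ∩ X ⁻¹' {y}).indicator 1 x) := by
    refine eexp_congr fun x _ => ?_
    by_cases hx : X x = y
    · subst hx
      by_cases hE : x ∈ E <;> simp [hE]
    · simp [hx]
  rw [h1, h2, eexp_const_mul, eexp_const_mul, mul_assoc]
  congr 1
  exact ofReal_condProb_mul p E _

/-- Only the positive part of `g` has to be controlled, which lets the real-valued gain be estimated
in `[0, ∞]`. -/
theorem expect_le_of_eexp_le {p : PMF α} {g : α → ℝ} {U : α → ℝ≥0∞} {K : ℝ} (hK : 0 ≤ K)
    (h1 : ∀ x, p x ≠ 0 → ENNReal.ofReal (g x) ≤ U x) (hU : eexp p U ≤ ENNReal.ofReal K) :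
    expect p g ≤ K := by
  set s : α → ℝ := fun x => (p x).toReal * g x
  by_cases hs : Summable s
  · have hp : Summable fun x => (ENNReal.ofReal (s x)).toReal := by
      have := hs.abs
      refine Summable.of_nonneg_of_le (fun _ => ENNReal.toReal_nonneg) (fun x => ?_) this
      rw [ENNReal.toReal_ofReal']
      exact max_le (le_abs_self _) (abs_nonneg _)
    have h2 : ∑' x, ENNReal.ofReal (s x) ≤ ENNReal.ofReal K := by
      refine le_trans (ENNReal.tsum_le_tsum fun x => ?_) hU
      by_cases hx : p x = 0
      · simp [s, hx]
      · simp only [s]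
        rw [ENNReal.ofReal_mul ENNReal.toReal_nonneg, ENNReal.ofReal_toReal (p.apply_ne_top x)]
        exact mul_le_mul_right (h1 x hx) _
    have h3 : expect p g ≤ ∑' x, (ENNReal.ofReal (s x)).toReal := by
      refine hs.tsum_le_tsum (fun x => ?_) hp
      rw [ENNReal.toReal_ofReal']
      exact le_max_left _ _
    rw [← ENNReal.tsum_toReal_eq (fun x => ENNReal.ofReal_ne_top)] at h3
    exact h3.trans (ENNReal.toReal_le_of_le_ofReal hK h2)
  -- A divergent series has the default value 0, which is covered by `0 ≤ K`.
  · rw [expect, tsum_eq_zero_of_not_summable hs]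
    exact hK

end Expectation

/-! ### The mass function of a sum of coins. -/

section CoinSum

variable (ε : Set.Icc (-1 : ℝ) 1)

/-- The probability that a coin is `1`. -/
noncomputable def headProb : ℝ≥0∞ := ENNReal.ofReal ((1 + ε) / 2)

/-- The probability that a coin is `-1`. -/
noncomputable def tailProb : ℝ≥0∞ := ENNReal.ofReal ((1 - ε) / 2)

theorem eexp_coin (g : ℤ → ℝ≥0∞) :
    eexp (coin ε) g = headProb ε * g 1 + tailProb ε * g (-1) := by
  rw [coin, eexp_map, eexp, tsum_fintype, Fintype.sum_bool]
  simp [headProb, tailProb]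

theorem eexp_coinSum_succ (n : ℕ) (g : ℤ → ℝ≥0∞) :
    eexp (coinSum ε (n + 1)) g = eexp (coinSum ε n) fun s => eexp (coin ε) fun c => g (s + c) := by
  rw [coinSum, eexp_bind]
  simp only [eexp_map]

theorem eexp_coinSum_add (a b : ℕ) (g : ℤ → ℝ≥0∞) :
    eexp (coinSum ε (a + b)) g =
      eexp (coinSum ε a) fun x => eexp (coinSum ε b) fun y => g (x + y) := by
  induction b generalizing g with
  | zero => simp [coinSum, eexp_pure]
  | succ b ih => rw [← add_assoc, eexp_coinSum_succ, ih]; simp only [eexp_coinSum_succ, add_assoc]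

theorem coinSum_zero_apply (a : ℤ) : coinSum ε 0 a = if a = 0 then 1 else 0 := by
  simp [coinSum, PMF.pure_apply]

theorem coinSum_succ_apply (n : ℕ) (a : ℤ) : coinSum ε (n + 1) a =
    headProb ε * coinSum ε n (a - 1) + tailProb ε * coinSum ε n (a + 1) := by
  rw [← pr_singleton, pr, eexp_coinSum_succ]
  simp only [eexp_coin, eexp_add, eexp_const_mul]
  rw [← pr_singleton (coinSum ε n) (a - 1), ← pr_singleton (coinSum ε n) (a + 1), pr, pr]
  congr 2
  · refine eexp_congr fun s _ => ?_
    by_cases h : s = a - 1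
    · subst h; simp
    · have : s + 1 ≠ a := by omega
      simp [h, this]
  · refine eexp_congr fun s _ => ?_
    by_cases h : s = a + 1
    · subst h; simp
    · have : s + -1 ≠ a := by omega
      simp [h, this]

theorem exists_eq_of_coinSum_ne_zero {n : ℕ} {a : ℤ} (h : coinSum ε n a ≠ 0) :
    ∃ k ≤ n, a = 2 * (k : ℤ) - n := by
  induction n generalizing a with
  | zero =>
    rw [coinSum_zero_apply] at h
    refine ⟨0, le_rfl, ?_⟩
    by_contra h'
    simp_all
  | succ n ih =>
    rw [coinSum_succ_apply] at h
    by_cases h1 : coinSum ε n (a - 1) = 0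
    · have h2 : coinSum ε n (a + 1) ≠ 0 := fun h2 => h (by rw [h1, h2]; simp)
      obtain ⟨k, hk, e⟩ := ih h2
      exact ⟨k, by omega, by push_cast; omega⟩
    · obtain ⟨k, hk, e⟩ := ih h1
      exact ⟨k + 1, by omega, by push_cast; omega⟩

theorem coinSum_apply (n k : ℕ) : coinSum ε n (2 * (k : ℤ) - n) =
    n.choose k * (headProb ε ^ k * tailProb ε ^ (n - k)) := by
  induction n generalizing k with
  | zero =>
    rw [coinSum_zero_apply]
    cases k with
    | zero => simp
    | succ k => simp; omega
  | succ n ih =>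
    rw [coinSum_succ_apply]
    have e2 : 2 * (k : ℤ) - (n + 1 : ℕ) + 1 = 2 * (k : ℤ) - n := by push_cast; ring
    rw [e2, ih k]
    cases k with
    | zero =>
      have : coinSum ε n (2 * ((0 : ℕ) : ℤ) - (n + 1 : ℕ) - 1) = 0 := by
        by_contra h
        obtain ⟨k, _, e⟩ := exists_eq_of_coinSum_ne_zero ε h
        push_cast at e
        omega
      rw [this]
      simp only [Nat.choose_zero_right, pow_zero, Nat.sub_zero]
      ring
    | succ k =>
      have e1 : 2 * ((k + 1 : ℕ) : ℤ) - (n + 1 : ℕ) - 1 = 2 * (k : ℤ) - n := by push_cast; ring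
      rw [e1, ih k, Nat.choose_succ_succ]
      rcases lt_or_ge k n with h | h
      · obtain ⟨d, rfl⟩ := Nat.exists_eq_add_of_lt h
        have e3 : k + d + 1 - (k + 1) = d := by omega
        have e4 : k + d + 1 - k = d + 1 := by omega
        have e5 : k + d + 1 + 1 - (k + 1) = d + 1 := by omega
        rw [e3, e4, e5]
        push_cast
        ring
      · rw [Nat.choose_eq_zero_of_lt (show n < k + 1 by omega)]
        have e4 : n - k = 0 := by omega
        have e5 : n + 1 - (k + 1) = 0 := by omega
        rw [e4, e5]
        push_cast
        ring

theorem coinSum_toReal (n k : ℕ) : (coinSum ε n (2 * (k : ℤ) - n)).toReal =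
    n.choose k * (((1 + ε) / 2) ^ k * ((1 - ε) / 2) ^ (n - k)) := by
  have h1 := ε.2.1
  have h2 := ε.2.2
  rw [coinSum_apply, headProb, tailProb]
  simp only [ENNReal.toReal_mul, ENNReal.toReal_natCast, ENNReal.toReal_pow]
  rw [ENNReal.toReal_ofReal (by linarith), ENNReal.toReal_ofReal (by linarith)]

/-- With `a = 2k - n` this is the quotient of consecutive binomial masses, cleared of denominators
so that `ε = ±1` is allowed. -/
theorem coinSum_step {n : ℕ} {a : ℤ} (hp : a ≡ n [ZMOD 2]) (h1 : -(n : ℤ) ≤ a) (h2 : a < n) :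
    ((n : ℝ) + a + 2) * (1 - ε) * (coinSum ε n (a + 2)).toReal =
      ((n : ℝ) - a) * (1 + ε) * (coinSum ε n a).toReal := by
  obtain ⟨k, rfl⟩ : ∃ k : ℕ, a = 2 * (k : ℤ) - n := by
    have := hp.symm.dvd
    exact ⟨((a + n) / 2).toNat, by omega⟩
  have hk : k < n := by omega
  have e : 2 * (k : ℤ) - n + 2 = 2 * ((k + 1 : ℕ) : ℤ) - n := by push_cast; ring
  rw [e, coinSum_toReal, coinSum_toReal]
  obtain ⟨d, rfl⟩ := Nat.exists_eq_add_of_lt hk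
  have e3 : k + d + 1 - (k + 1) = d := by omega
  have e4 : k + d + 1 - k = d + 1 := by omega
  have hc := Nat.choose_succ_right_eq (k + d + 1) k
  rw [e4] at hc
  have hc' : ((k + d + 1).choose (k + 1) : ℝ) * (k + 1) = (k + d + 1).choose k * (d + 1) := by
    exact_mod_cast hc
  rw [e3, e4]
  push_cast
  linear_combination (4 * ((1 + (ε : ℝ)) / 2) ^ (k + 1) * ((1 - ε) / 2) ^ (d + 1)) * hc'

/-- This yields `centralBinom k ≤ 4^k / √(2k + 1)`; the induction step amounts to `(2k + 3)(2k + 1)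
≤ 4(k + 1)²`. -/
theorem two_mul_add_one_mul_centralBinom_sq_le (k : ℕ) :
    (2 * k + 1) * k.centralBinom ^ 2 ≤ 16 ^ k := by
  induction k with
  | zero => simp
  | succ k ih =>
    have h := Nat.succ_mul_centralBinom_succ k
    have hpos : 0 < (k + 1) ^ 2 := by positivity
    refine Nat.le_of_mul_le_mul_left ?_ hpos
    calc (k + 1) ^ 2 * ((2 * (k + 1) + 1) * (k + 1).centralBinom ^ 2)
        = (2 * k + 3) * ((k + 1) * (k + 1).centralBinom) ^ 2 := by ring
      _ = (4 * (2 * k + 3) * (2 * k + 1)) * ((2 * k + 1) * k.centralBinom ^ 2) := by rw [h]; ring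
      _ ≤ (16 * (k + 1) ^ 2) * 16 ^ k := Nat.mul_le_mul (by nlinarith) ih
      _ = (k + 1) ^ 2 * 16 ^ (k + 1) := by ring

theorem choose_odd_le (r k : ℕ) : (2 * k + 1).choose r ≤ 2 * k.centralBinom := by
  cases r with
  | zero => simpa using Nat.succ_le_of_lt (Nat.mul_pos two_pos k.centralBinom_pos)
  | succ r =>
    rw [Nat.choose_succ_succ]
    have := Nat.choose_le_centralBinom r k
    have := Nat.choose_le_centralBinom (r + 1) k
    simp only [Nat.succ_eq_add_one] at *
    omega

/-- Pairing heads with tails uses `pq ≤ 1/4`. The `a` unpaired factors exceed `(1/2)^a` by at most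
`(1 + e)^a ≤ exp (e a) ≤ 3`. -/
theorem pow_add_mul_pow_le {p q e : ℝ} (hp : 0 ≤ p) (hq : 0 ≤ q) (hpq : p * q ≤ 1 / 4)
    (he : p ≤ (1 + e) / 2) (a i : ℕ) (ha : e * a ≤ 1) :
    p ^ (a + i) * q ^ i ≤ 3 * (1 / 2) ^ (a + 2 * i) := by
  have h1 : (p * q) ^ i ≤ (1 / 4) ^ i := pow_le_pow_left₀ (mul_nonneg hp hq) hpq i
  have h2 : p ^ a ≤ (1 / 2) ^ a * 3 := by
    have h3 : p ≤ 1 / 2 * Real.exp e := by linarith [Real.add_one_le_exp e]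
    calc p ^ a ≤ (1 / 2 * Real.exp e) ^ a := pow_le_pow_left₀ hp h3 a
      _ = (1 / 2) ^ a * Real.exp (e * a) := by rw [mul_pow, ← Real.exp_nat_mul, mul_comm e]
      _ ≤ (1 / 2) ^ a * Real.exp 1 := by gcongr
      _ ≤ (1 / 2) ^ a * 3 := by gcongr; linarith [Real.exp_one_lt_d9]
  calc p ^ (a + i) * q ^ i = p ^ a * (p * q) ^ i := by ring
    _ ≤ ((1 / 2) ^ a * 3) * (1 / 4) ^ i := by gcongr
    _ = 3 * (1 / 2) ^ (a + 2 * i) := by rw [pow_add, pow_mul]; norm_num; ring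

/-- Near the origin, the mass function of a slightly biased binomial is `O(1 / √n)`. -/
theorem coinSum_toReal_le {n : ℕ} (hn : Odd n) (a : ℤ) (ha : |(ε : ℝ)| * |(a : ℝ)| ≤ 1) :
    (coinSum ε n a).toReal ≤ 3 / √n := by
  by_cases h0 : coinSum ε n a = 0
  · rw [h0, ENNReal.toReal_zero]; positivity
  obtain ⟨k, hk, rfl⟩ := exists_eq_of_coinSum_ne_zero ε h0
  have h1 := ε.2.1
  have h2 := ε.2.2
  have hpq : (1 + (ε : ℝ)) / 2 * ((1 - ε) / 2) ≤ 1 / 4 := by nlinarith [sq_nonneg (ε : ℝ)]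
  have key : ((1 + (ε : ℝ)) / 2) ^ k * ((1 - ε) / 2) ^ (n - k) ≤ 3 * (1 / 2) ^ n := by
    -- The unpaired coins all show the majority face, and their number is the absolute value of the
    -- sum.
    rcases le_total (n - k) k with h | h
    · obtain ⟨d, hd⟩ := Nat.exists_eq_add_of_le' h
      have e1 : k = d + (n - k) := hd
      have e2 : n = d + 2 * (n - k) := by omega
      have e3 : |((2 * (k : ℤ) - n : ℤ) : ℝ)| = d := by
        have : (2 * (k : ℤ) - n : ℤ) = d := by omega
        rw [this]; simp
      rw [e3] at ha
      have := pow_add_mul_pow_le (e := |(ε : ℝ)|) (by linarith) (by linarith) hpq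
        (by linarith [le_abs_self (ε : ℝ)]) d (n - k) ha
      rwa [← e1, ← e2] at this
    · obtain ⟨d, hd⟩ := Nat.exists_eq_add_of_le' h
      have e2 : n = d + 2 * k := by omega
      have e3 : |((2 * (k : ℤ) - n : ℤ) : ℝ)| = d := by
        have : (2 * (k : ℤ) - n : ℤ) = -d := by omega
        rw [this]; simp
      rw [e3] at ha
      have := pow_add_mul_pow_le (e := |(ε : ℝ)|) (p := (1 - ε) / 2) (q := (1 + ε) / 2)
        (by linarith) (by linarith) (by linarith)
        (by linarith [neg_abs_le (ε : ℝ)]) d k ha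
      rw [← e2, ← hd] at this
      linarith
  rw [coinSum_toReal]
  obtain ⟨j, rfl⟩ := hn
  have hc : ((2 * j + 1).choose k : ℝ) ≤ 2 * j.centralBinom := by exact_mod_cast choose_odd_le k j
  have hb : (j.centralBinom : ℝ) * √((2 * j + 1 : ℕ) : ℝ) ≤ 4 ^ j := by
    refine le_of_sq_le_sq ?_ (by positivity)
    rw [mul_pow, Real.sq_sqrt (by positivity), ← pow_mul, mul_comm j, pow_mul]
    have := two_mul_add_one_mul_centralBinom_sq_le j
    norm_num
    rw [mul_comm]
    exact_mod_cast this
  have hs : 0 < √((2 * j + 1 : ℕ) : ℝ) := Real.sqrt_pos.2 (by positivity)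
  have h4 : (4 : ℝ) ^ j * (1 / 2) ^ (2 * j + 1) = 1 / 2 := by
    rw [pow_succ, pow_mul, ← mul_assoc, ← mul_pow]; norm_num
  rw [le_div_iff₀ hs]
  calc ((2 * j + 1).choose k : ℝ) * (((1 + (ε : ℝ)) / 2) ^ k * ((1 - ε) / 2) ^ (2 * j + 1 - k)) *
        √((2 * j + 1 : ℕ) : ℝ)
      ≤ (2 * j.centralBinom) * (3 * (1 / 2) ^ (2 * j + 1)) * √((2 * j + 1 : ℕ) : ℝ) := by
        gcongr
        exact mul_nonneg (pow_nonneg (by linarith) _) (pow_nonneg (by linarith) _)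
    _ = 6 * (1 / 2) ^ (2 * j + 1) * (j.centralBinom * √((2 * j + 1 : ℕ) : ℝ)) := by ring
    _ ≤ 6 * (1 / 2) ^ (2 * j + 1) * 4 ^ j := by gcongr
    _ = 3 := by linear_combination 6 * h4

end CoinSum

/-! ### Hoeffding's inequality for coins. -/

section Tail

-- Hoeffding's lemma: the centred coin lives in an interval of length 2, so its variance proxy is 1.
open MeasureTheory ProbabilityTheory in
theorem coin_mgf_le (e s : ℝ) (h1 : -1 ≤ e) (h2 : e ≤ 1) :
    (1 + e) / 2 * Real.exp (s * (1 - e)) + (1 - e) / 2 * Real.exp (s * (-1 - e)) ≤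
      Real.exp (s ^ 2 / 2) := by
  have hq : ENNReal.ofReal ((1 + e) / 2) + ENNReal.ofReal ((1 - e) / 2) = 1 := by
    rw [← ENNReal.ofReal_add (by linarith) (by linarith), ← ENNReal.ofReal_one]
    congr 1; ring
  let p : PMF Bool := PMF.ofFintype (fun o => if o then ENNReal.ofReal ((1 + e) / 2)
    else ENNReal.ofReal ((1 - e) / 2)) (by simpa using hq)
  let X : Bool → ℝ := fun o => if o then 1 - e else -1 - e
  have hI (g : Bool → ℝ) : ∫ o, g o ∂p.toMeasure = (1 + e) / 2 * g true + (1 - e) / 2 * g false := by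
    rw [PMF.integral_eq_sum, Fintype.sum_bool]
    simp only [p, PMF.ofFintype_apply, if_true, Bool.false_eq_true, if_false, smul_eq_mul]
    rw [ENNReal.toReal_ofReal (by linarith), ENNReal.toReal_ofReal (by linarith)]
  have h := hasSubgaussianMGF_of_mem_Icc_of_integral_eq_zero (μ := p.toMeasure) (X := X)
    (a := -1 - e) (b := 1 - e) (measurable_of_finite _).aemeasurable
    (Filter.Eventually.of_forall fun o => by cases o <;> simp [X] ) (by rw [hI]; simp [X]; ring)
  have h3 := h.mgf_le s
  rw [mgf, hI] at h3
  have h4 : (((‖(1 - e) - (-1 - e)‖₊ / 2) ^ 2 : NNReal) : ℝ) = 1 := by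
    have : (1 - e) - (-1 - e) = 2 := by ring
    rw [this]; simp
  rw [h4] at h3
  simpa [X] using h3

variable (ε : Set.Icc (-1 : ℝ) 1)

theorem eexp_exp_le (n : ℕ) (s : ℝ) :
    eexp (coinSum ε n) (fun x => ENNReal.ofReal (Real.exp (s * (x - ε * n)))) ≤
      ENNReal.ofReal (Real.exp (n * (s ^ 2 / 2))) := by
  have h1 := ε.2.1
  have h2 := ε.2.2
  induction n with
  | zero => simp [coinSum, eexp_pure]
  | succ n ih =>
    rw [eexp_coinSum_succ]
    have h (x : ℤ) : eexp (coin ε) (fun c => ENNReal.ofReal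
        (Real.exp (s * (((x + c : ℤ) : ℝ) - ε * (n + 1 : ℕ))))) ≤
        ENNReal.ofReal (Real.exp (s * (x - ε * n))) * ENNReal.ofReal (Real.exp (s ^ 2 / 2)) := by
      rw [eexp_coin, headProb, tailProb, ← ENNReal.ofReal_mul (by linarith),
        ← ENNReal.ofReal_mul (by linarith), ← ENNReal.ofReal_add
          (mul_nonneg (by linarith) (Real.exp_pos _).le)
          (mul_nonneg (by linarith) (Real.exp_pos _).le), ← ENNReal.ofReal_mul (Real.exp_pos _).le]
      refine ENNReal.ofReal_le_ofReal ?_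
      have e1 : s * (((x + 1 : ℤ) : ℝ) - ε * (n + 1 : ℕ)) = s * (x - ε * n) + s * (1 - ε) := by
        push_cast; ring
      have e2 : s * (((x + -1 : ℤ) : ℝ) - ε * (n + 1 : ℕ)) = s * (x - ε * n) + s * (-1 - ε) := by
        push_cast; ring
      rw [e1, e2, Real.exp_add, Real.exp_add]
      have := mul_le_mul_of_nonneg_left (coin_mgf_le ε s h1 h2) (Real.exp_pos (s * (x - ε * n))).le
      linarith
    refine (eexp_mono fun x _ => h x).trans ?_
    rw [eexp_mul_const]
    refine (mul_le_mul_left ih _).trans_eq ?_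
    rw [← ENNReal.ofReal_mul (Real.exp_pos _).le, ← Real.exp_add]
    congr 2
    push_cast
    ring

/-- Chernoff's bound; `s` may have either sign, so both tails are covered. -/
theorem pr_tail_le (n : ℕ) (s t : ℝ) :
    pr (coinSum ε n) {x | t ≤ s * (x - ε * n)} ≤
      ENNReal.ofReal (Real.exp (n * (s ^ 2 / 2) - t)) := by
  have h : pr (coinSum ε n) {x | t ≤ s * (x - ε * n)} ≤ eexp (coinSum ε n) (fun x =>
      ENNReal.ofReal (Real.exp (s * (x - ε * n))) * ENNReal.ofReal (Real.exp (-t))) := by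
    refine eexp_mono fun x _ => ?_
    by_cases hx : t ≤ s * (x - ε * n)
    · rw [Set.indicator_of_mem (by exact hx), ← ENNReal.ofReal_mul (Real.exp_pos _).le,
        ← Real.exp_add, Pi.one_apply, ENNReal.one_le_ofReal, Real.one_le_exp_iff]
      linarith
    · rw [Set.indicator_of_notMem (by exact hx)]
      exact zero_le
  refine h.trans ?_
  rw [eexp_mul_const, sub_eq_add_neg, Real.exp_add, ENNReal.ofReal_mul (Real.exp_pos _).le]
  exact mul_le_mul_left (eexp_exp_le ε n s) _

/-- Hoeffding's inequality for `n` coins, with deviation `4 √(L n)`. -/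
theorem pr_deviation_le (n : ℕ) {L : ℝ} (hL : 0 ≤ L) :
    pr (coinSum ε n) {x | 4 * √(L * n) < |(x : ℝ) - ε * n|} ≤
      ENNReal.ofReal (2 * Real.exp (-8 * L)) := by
  rcases Nat.eq_zero_or_pos n with rfl | hn
  · have : pr (coinSum ε 0) {x | 4 * √(L * (0 : ℕ)) < |(x : ℝ) - ε * (0 : ℕ)|} = 0 := by
      rw [pr, coinSum, eexp_pure]; simp
    rw [this]; exact zero_le
  have hn' : (0 : ℝ) < n := by exact_mod_cast hn
  set r := √(L * n) with hr
  have hr2 : r ^ 2 = L * n := Real.sq_sqrt (by positivity)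
  have hr0 : 0 ≤ r := Real.sqrt_nonneg _
  -- The slope `s = ±4r/n` is optimal: then `n s²/2 = 8L`, against the threshold `16L`.
  have hsub : {x : ℤ | 4 * r < |(x : ℝ) - ε * n|} ⊆
      {x : ℤ | 16 * L ≤ (4 * r / n) * ((x : ℝ) - ε * n)} ∪
      {x : ℤ | 16 * L ≤ (-(4 * r / n)) * ((x : ℝ) - ε * n)} := by
    intro x hx
    have hx' : 4 * r < |(x : ℝ) - ε * n| := hx
    have e : 16 * L = 4 * r / n * (4 * r) := by field_simp; linear_combination -16 * hr2
    have h0 : 0 ≤ 4 * r / n := by positivity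
    rcases lt_abs.1 hx' with h | h
    · left
      show 16 * L ≤ _
      rw [e]; exact mul_le_mul_of_nonneg_left h.le h0
    · right
      show 16 * L ≤ _
      rw [e, neg_mul, ← mul_neg]; exact mul_le_mul_of_nonneg_left h.le h0
  have hs : (n : ℝ) * ((4 * r / n) ^ 2 / 2) - 16 * L = -8 * L := by
    field_simp; linear_combination 16 * hr2
  refine (pr_mono _ hsub).trans ((pr_union_le _ _ _).trans ?_)
  refine (add_le_add (pr_tail_le ε n _ _) (pr_tail_le ε n _ _)).trans_eq ?_
  rw [neg_sq, hs, ← ENNReal.ofReal_add (Real.exp_pos _).le (Real.exp_pos _).le]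
  congr 1; ring

end Tail

/-! ### Slow variation of the binomial mass function. -/

section Ratio

variable (ε : Set.Icc (-1 : ℝ) 1)

/-- By `coinSum_step` the quotient in either direction is at most `(1 + u)(1 + e) / ((1 - u)(1 -
e))` with `u = w/n`. -/
theorem coinSum_ratio_step {n : ℕ} {a : ℤ} {w e θ : ℝ} (hn : 0 < n) (hp : a ≡ n [ZMOD 2])
    (h1 : |(a : ℝ)| ≤ w) (h2 : |((a + 2 : ℤ) : ℝ)| ≤ w) (hw : w ≤ n / 4) (hε : |(ε : ℝ)| ≤ e)
    (he : e ≤ 1 / 4) (hθ : 4 * (w / n + e) ≤ θ) :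
    (coinSum ε n (a + 2)).toReal ≤ (1 + θ) * (coinSum ε n a).toReal ∧
      (coinSum ε n a).toReal ≤ (1 + θ) * (coinSum ε n (a + 2)).toReal := by
  have hn' : (0 : ℝ) < n := by exact_mod_cast hn
  have ha := abs_le.1 h1
  have ha2 := abs_le.1 h2
  push_cast at ha2
  have hee := abs_le.1 hε
  set u := w / n with hu
  have hw' : w = u * n := by rw [hu]; field_simp
  have hu4 : u ≤ 1 / 4 := by rw [hu, div_le_iff₀ hn']; linarith
  have hu0 : 0 ≤ u := div_nonneg ((abs_nonneg _).trans h1) hn'.le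
  have he0 : 0 ≤ e := (abs_nonneg _).trans hε
  have hs := coinSum_step ε hp (by
    have : (-(n : ℝ)) ≤ a := by linarith
    exact_mod_cast this) (by
    have : (a : ℝ) < n := by linarith
    exact_mod_cast this)
  set x := (coinSum ε n a).toReal
  set y := (coinSum ε n (a + 2)).toReal
  have hx : 0 ≤ x := ENNReal.toReal_nonneg
  have hy : 0 ≤ y := ENNReal.toReal_nonneg
  have hlo : (n : ℝ) * (1 - u) * (1 - e) > 0 := by
    have : 0 < 1 - u := by linarith
    have : 0 < 1 - e := by linarith
    positivity
  -- The two products differ by exactly `2(u + e)`, while the smaller one is at least `9/16` and `θ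
  -- ≥ 4(u + e)`.
  have hbd : (n : ℝ) * (1 + u) * (1 + e) ≤ (1 + θ) * (n * (1 - u) * (1 - e)) := by
    have : (1 + u) * (1 + e) ≤ (1 + θ) * ((1 - u) * (1 - e)) := by
      have h9 : 9 / 16 ≤ (1 - u) * (1 - e) := by nlinarith
      nlinarith
    calc (n : ℝ) * (1 + u) * (1 + e) = n * ((1 + u) * (1 + e)) := by ring
      _ ≤ n * ((1 + θ) * ((1 - u) * (1 - e))) := by gcongr
      _ = (1 + θ) * (n * (1 - u) * (1 - e)) := by ring
  have hm1 : (n : ℝ) * (1 - u) = n - w := by rw [hw']; ring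
  have hm2 : (n : ℝ) * (1 + u) = n + w := by rw [hw']; ring
  constructor
  · refine le_of_mul_le_mul_left ?_ hlo
    calc (n : ℝ) * (1 - u) * (1 - e) * y ≤ ((n : ℝ) + a + 2) * (1 - ε) * y := by
          refine mul_le_mul_of_nonneg_right (mul_le_mul ?_ ?_ ?_ ?_) hy <;> linarith
      _ = ((n : ℝ) - a) * (1 + ε) * x := hs
      _ ≤ (n : ℝ) * (1 + u) * (1 + e) * x := by
          refine mul_le_mul_of_nonneg_right (mul_le_mul ?_ ?_ ?_ ?_) hx <;> linarith
      _ ≤ (1 + θ) * (n * (1 - u) * (1 - e)) * x := by gcongr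
      _ = (n : ℝ) * (1 - u) * (1 - e) * ((1 + θ) * x) := by ring
  · refine le_of_mul_le_mul_left ?_ hlo
    calc (n : ℝ) * (1 - u) * (1 - e) * x ≤ ((n : ℝ) - a) * (1 + ε) * x := by
          refine mul_le_mul_of_nonneg_right (mul_le_mul ?_ ?_ ?_ ?_) hx <;> linarith
      _ = ((n : ℝ) + a + 2) * (1 - ε) * y := hs.symm
      _ ≤ (n : ℝ) * (1 + u) * (1 + e) * y := by
          refine mul_le_mul_of_nonneg_right (mul_le_mul ?_ ?_ ?_ ?_) hy <;> linarith
      _ ≤ (1 + θ) * (n * (1 - u) * (1 - e)) * y := by gcongr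
      _ = (n : ℝ) * (1 - u) * (1 - e) * ((1 + θ) * y) := by ring

/-- The mass function of a slightly biased binomial varies slowly near its centre. -/
theorem coinSum_ratio {n : ℕ} {a b : ℤ} {w e θ N : ℝ} (hn : 0 < n) (ha : a ≡ n [ZMOD 2])
    (hb : b ≡ n [ZMOD 2]) (h1 : |(a : ℝ)| ≤ w) (h2 : |(b : ℝ)| ≤ w) (hw : w ≤ n / 4)
    (hε : |(ε : ℝ)| ≤ e) (he : e ≤ 1 / 4) (hθ : 4 * (w / n + e) ≤ θ)
    (hab : |(a : ℝ) - b| ≤ 2 * N) (hN : θ * N ≤ 1) :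
    (coinSum ε n a).toReal ≤ 3 * (coinSum ε n b).toReal := by
  have hn' : (0 : ℝ) < n := by exact_mod_cast hn
  have hw0 : 0 ≤ w := (abs_nonneg _).trans h1
  have hθ0 : 0 ≤ θ := le_trans (by have := (abs_nonneg _).trans hε; positivity) hθ
  -- Steps of length 2 stay in the parity class of `n`; each costs a factor `1 + θ`, in both
  -- directions.
  have hp (i : ℕ) (c : ℤ) (hc : c ≡ n [ZMOD 2]) (k1 : -w ≤ c) (k2 : (c : ℝ) + 2 * i ≤ w) :
      (coinSum ε n (c + 2 * i)).toReal ≤ (1 + θ) ^ i * (coinSum ε n c).toReal ∧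
      (coinSum ε n c).toReal ≤ (1 + θ) ^ i * (coinSum ε n (c + 2 * i)).toReal := by
    induction i with
    | zero => simp
    | succ i ih =>
      push_cast at k2
      obtain ⟨g1, g2⟩ := ih (by linarith)
      have hi : (0 : ℝ) ≤ i := by positivity
      obtain ⟨f1, f2⟩ := coinSum_ratio_step ε (a := c + 2 * i) hn
        (by
          have : (c + 2 * i) ≡ c + 0 [ZMOD 2] := Int.ModEq.add_left _ (by simp [Int.ModEq])
          rw [add_zero] at this
          exact this.trans hc)
        (abs_le.2 ⟨by push_cast; linarith, by push_cast; linarith⟩)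
        (abs_le.2 ⟨by push_cast; linarith, by push_cast; linarith⟩) hw hε he hθ
      have e : c + 2 * ((i + 1 : ℕ) : ℤ) = c + 2 * i + 2 := by push_cast; ring
      rw [e, pow_succ]
      have hq : 0 ≤ (1 + θ) ^ i := by positivity
      constructor
      · calc _ ≤ _ := f1
          _ ≤ (1 + θ) * ((1 + θ) ^ i * (coinSum ε n c).toReal) := by gcongr
          _ = _ := by ring
      · calc _ ≤ _ := g2
          _ ≤ (1 + θ) ^ i * ((1 + θ) * (coinSum ε n (c + 2 * i + 2)).toReal) := by gcongr
          _ = _ := by ring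
  have hpow (i : ℕ) (hi : (i : ℝ) ≤ N) : (1 + θ) ^ i ≤ 3 := by
    calc (1 + θ) ^ i ≤ Real.exp θ ^ i := by
          gcongr; linarith [Real.add_one_le_exp θ]
      _ = Real.exp (i * θ) := by rw [← Real.exp_nat_mul]
      _ ≤ Real.exp 1 := by
          gcongr
          calc (i : ℝ) * θ ≤ N * θ := by gcongr
            _ ≤ 1 := by linarith
      _ ≤ 3 := by linarith [Real.exp_one_lt_d9]
  have hdvd := (ha.trans hb.symm).dvd
  have h1' := abs_le.1 h1
  have h2' := abs_le.1 h2
  have hab' := abs_le.1 hab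
  rcases le_total a b with h | h
  · obtain ⟨i, hi⟩ : ∃ i : ℕ, b = a + 2 * i := ⟨((b - a) / 2).toNat, by omega⟩
    subst hi
    push_cast at hab' h2'
    have := (hp i a ha (by linarith) (by linarith)).2
    refine this.trans ?_
    gcongr
    exact hpow i (by linarith)
  · obtain ⟨i, hi⟩ : ∃ i : ℕ, a = b + 2 * i := ⟨((a - b) / 2).toNat, by omega⟩
    subst hi
    push_cast at hab' h1'
    have := (hp i b hb (by linarith) (by linarith)).1
    refine this.trans ?_
    gcongr
    exact hpow i (by linarith)

end Ratio

/-! ### Independence and conditional laws in the game. -/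

section Game

variable {H : Type*} (m : ℕ) (ε : Set.Icc (-1 : ℝ) 1) (f : ℕ → ℤ → ℤ → PMF H)

theorem eexp_transcript_succ (k : ℕ) (g : (Fin (k + 1) → ℤ × H) → ℝ≥0∞) :
    eexp (transcript m ε f (k + 1)) g = eexp (transcript m ε f k) fun ω =>
      eexp (coinSum ε ((m - k) ^ 2)) fun c => eexp (f (k + 1) (∑ j, (ω j).1) c) fun h =>
        g (Fin.snoc (α := fun _ => ℤ × H) ω (c, h)) := by
  rw [transcript, eexp_bind]
  simp only [eexp_bind, eexp_map]

theorem sum_snoc_fst {k : ℕ} (ω : Fin k → ℤ × H) (c : ℤ) (h : H) :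
    ∑ j, ((Fin.snoc (α := fun _ => ℤ × H) ω (c, h) : Fin (k + 1) → ℤ × H) j).1 =
      ∑ j, (ω j).1 + c := by
  rw [Fin.sum_univ_castSucc]
  simp

/-- Hints of later rounds integrate to 1 because `ψ` sees only coins, and the coins of those rounds
merge into one `coinSum`. Removing the last round replaces `ψ` by its average, so the induction must
range over all `ψ`. -/
theorem eexp_transcript_mul {k n : ℕ} (hkn : k ≤ n) (φ : (Fin k → ℤ × H) → ℝ≥0∞)
    (ψ : ℤ → ℝ≥0∞) :
    eexp (transcript m ε f n)
        (fun ω => φ (fun i => ω (Fin.castLE hkn i)) * ψ (∑ j, (ω j).1)) =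
      eexp (transcript m ε f k) (fun ω => φ ω *
        eexp (coinSum ε (∑ i ∈ Finset.Ico k n, (m - i) ^ 2)) fun x => ψ (∑ j, (ω j).1 + x)) := by
  induction n, hkn using Nat.le_induction generalizing ψ with
  | base => simp [coinSum, eexp_pure]
  | succ n hkn ih =>
    rw [eexp_transcript_succ]
    have h1 (ω : Fin n → ℤ × H) (c : ℤ) (h : H) :
        (fun i : Fin k => (Fin.snoc (α := fun _ => ℤ × H) ω (c, h) : Fin (n + 1) → ℤ × H)
          (Fin.castLE (hkn.trans n.le_succ) i)) = fun i => ω (Fin.castLE hkn i) := by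
      funext i
      exact Fin.snoc_castSucc (α := fun _ => ℤ × H) (c, h) ω (Fin.castLE hkn i)
    simp only [sum_snoc_fst, h1, eexp_const, eexp_const_mul]
    rw [ih (fun s => eexp (coinSum ε ((m - n) ^ 2)) fun c => ψ (s + c))]
    rw [Finset.sum_Ico_succ_top hkn]
    simp only [eexp_coinSum_add, add_assoc]

theorem sum_Ico_sq {k : ℕ} (hk : k ≤ m) : ∑ i ∈ Finset.Ico k m, (m - i) ^ 2 = rem (m - k) := by
  rw [rem]
  refine Finset.sum_bij' (fun i _ => m - i) (fun i _ => m - i) ?_ ?_ ?_ ?_ (fun _ _ => rfl) <;>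
    simp only [Finset.mem_Ico, Finset.mem_Icc] <;> omega

theorem rem_succ (ℓ : ℕ) : rem (ℓ + 1) = (ℓ + 1) ^ 2 + rem ℓ := by
  rw [rem, Finset.sum_Icc_succ_top (by omega), add_comm, rem]

variable {m}

theorem partialSum_last (ω : Fin m → ℤ × H) : partialSum ω m = ∑ j, (ω j).1 := by
  simp [partialSum]

theorem partialSum_eq_sum_castLE (ω : Fin m → ℤ × H) {k : ℕ} (hk : k ≤ m) :
    partialSum ω k = ∑ j : Fin k, (ω (Fin.castLE hk j)).1 := by
  rw [partialSum]
  refine (Finset.sum_bij' (fun j _ => Fin.castLE hk j)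
    (fun (i : Fin m) hi => ⟨i, by simpa using hi⟩) ?_ ?_ ?_ ?_ ?_).symm <;> simp

theorem partialSum_succ (ω : Fin m → ℤ × H) (j : Fin m) :
    partialSum ω (j + 1) = partialSum ω j + (ω j).1 := by
  rw [partialSum_eq_sum_castLE ω (show (j : ℕ) + 1 ≤ m from j.2), Fin.sum_univ_castSucc,
    partialSum_eq_sum_castLE ω j.2.le]
  rfl

theorem partialSum_congr {ω ω' : Fin m → ℤ × H} {k : ℕ}
    (h : ∀ i : Fin m, (i : ℕ) < k → ω i = ω' i) : partialSum ω k = partialSum ω' k := by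
  rw [partialSum, partialSum]
  refine Finset.sum_congr rfl fun i hi => ?_
  rw [h i (by simpa using hi)]

theorem exists_prefix {k : ℕ} (hk : k ≤ m) {φ : (Fin m → ℤ × H) → ℝ≥0∞}
    (hφ : DependsOn φ {i | (i : ℕ) < k}) [Nonempty H] :
    ∃ φ' : (Fin k → ℤ × H) → ℝ≥0∞, φ = fun ω => φ' fun i => ω (Fin.castLE hk i) := by
  classical
  refine ⟨fun ω => φ fun i => if h : (i : ℕ) < k then ω ⟨i, h⟩ else Classical.arbitrary _, ?_⟩
  funext ω
  refine hφ fun i hi => ?_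
  rw [dif_pos (show (i : ℕ) < k from hi)]
  rfl

/-- Conditionally on the first `k` rounds, the remaining coins are fresh. -/
theorem eexp_game_mul {k : ℕ} (hk : k ≤ m) {φ : (Fin m → ℤ × H) → ℝ≥0∞}
    (hφ : DependsOn φ {i | (i : ℕ) < k}) (ψ : ℤ → ℝ≥0∞) :
    eexp (game m ε f) (fun ω => φ ω * ψ (partialSum ω m)) =
      eexp (game m ε f) (fun ω => φ ω *
        eexp (coinSum ε (rem (m - k))) fun x => ψ (partialSum ω k + x)) := by
  -- The support of any hint law supplies the filler element needed by `exists_prefix`.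
  have : Nonempty H := (f 0 0 0).support_nonempty.to_type
  obtain ⟨φ', rfl⟩ := exists_prefix hk hφ
  simp only [partialSum_last, partialSum_eq_sum_castLE _ hk]
  rw [game, eexp_transcript_mul m ε f hk φ' ψ, sum_Ico_sq m hk]
  -- A second use, with trivial `ψ`, returns from the law of the prefix to the law of the full game.
  have := eexp_transcript_mul m ε f hk (fun ω => φ' ω *
    eexp (coinSum ε (rem (m - k))) fun x => ψ (∑ j, (ω j).1 + x)) (fun _ => 1)
  simp only [mul_one, eexp_const] at this
  exact this.symm

/-- The coins of round `j + 1` are independent of the first `j` rounds. -/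
theorem eexp_game_mul_coin (j : Fin m) {φ : (Fin m → ℤ × H) → ℝ≥0∞}
    (hφ : DependsOn φ {i | (i : ℕ) < j}) (ψ : ℤ → ℝ≥0∞) :
    eexp (game m ε f) (fun ω => φ ω * ψ (ω j).1) =
      eexp (game m ε f) φ * eexp (coinSum ε (level j ^ 2)) ψ := by
  have : Nonempty H := (f 0 0 0).support_nonempty.to_type
  obtain ⟨φ', rfl⟩ := exists_prefix j.2.le hφ
  have h1 := eexp_transcript_mul m ε f (show (j : ℕ) + 1 ≤ m from j.2)
    (fun ω => φ' (fun i => ω (Fin.castSucc i)) * ψ (ω (Fin.last _)).1) (fun _ => 1)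
  have h2 := eexp_transcript_mul m ε f j.2.le φ' (fun _ => 1)
  simp only [mul_one, eexp_const] at h1 h2
  rw [game, h2]
  refine h1.trans ?_
  rw [eexp_transcript_succ]
  simp only [Fin.snoc_castSucc, Fin.snoc_last, eexp_const, eexp_const_mul, eexp_mul_const]
  rfl

theorem dependsOn_indicator_noHint (j : Fin m) (b : ℤ) :
    DependsOn ((noHint j b).indicator 1 : (Fin m → ℤ × H) → ℝ≥0∞) {i | (i : ℕ) < j} := by
  intro ω ω' h
  have := partialSum_congr h
  simp only [Set.indicator_apply, noHint, Set.mem_ofPred_eq, this, Pi.one_apply]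

theorem dependsOn_indicator_withHint (j : Fin m) (b : ℤ) (a : H) :
    DependsOn ((withHint j b a).indicator 1 : (Fin m → ℤ × H) → ℝ≥0∞)
      {i | (i : ℕ) < (j : ℕ) + 1} := by
  intro ω ω' h
  have h1 := partialSum_congr (k := j) fun i hi => h i (Nat.lt_succ_of_lt hi)
  have h2 : ω j = ω' j := h j (Nat.lt_succ_self _)
  have h3 : ω ∈ withHint j b a ↔ ω' ∈ withHint j b a := by
    simp only [withHint, Set.mem_ofPred_eq, h1, h2]
  by_cases h4 : ω' ∈ withHint j b a
  · exact (Set.indicator_of_mem (h3.2 h4) 1).trans (Set.indicator_of_mem h4 1).symm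
  · exact (Set.indicator_of_notMem (fun h => h4 (h3.1 h)) 1).trans
      (Set.indicator_of_notMem h4 1).symm

/-- Conditional probabilities of final states given a no-hint state. -/
theorem condProb_noHint {j : Fin m} {b : ℤ} (h0 : pr (game m ε f) (noHint j b) ≠ 0) (T : Set ℤ) :
    condProb (game m ε f) {ω | partialSum ω m ∈ T} (noHint j b) =
      (pr (coinSum ε (rem (level j))) {x | b + x ∈ T}).toReal := by
  have h1 := ofReal_condProb_mul (game m ε f) {ω | partialSum ω m ∈ T} (noHint j b)
  have h2 : pr (game m ε f) ({ω | partialSum ω m ∈ T} ∩ noHint j b) =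
      pr (coinSum ε (rem (level j))) {x | b + x ∈ T} * pr (game m ε f) (noHint j b) := by
    have e1 : pr (game m ε f) ({ω | partialSum ω m ∈ T} ∩ noHint j b) =
        eexp (game m ε f) (fun ω => (noHint j b).indicator 1 ω *
          T.indicator 1 (partialSum ω m)) := by
      refine eexp_congr fun ω _ => ?_
      by_cases g1 : ω ∈ noHint j b <;> by_cases g2 : partialSum ω m ∈ T <;> simp [g1, g2]
    rw [e1, eexp_game_mul ε f j.2.le (dependsOn_indicator_noHint j b) (T.indicator 1), pr, pr,
      ← eexp_const_mul]
    refine eexp_congr fun ω _ => ?_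
    by_cases g1 : ω ∈ noHint j b
    · have g2 : partialSum ω j = b := g1
      simp only [g1, Set.indicator_of_mem, Pi.one_apply, one_mul, mul_one, g2]
      rfl
    · simp [g1]
  rw [h2] at h1
  have h3 := (ENNReal.mul_left_inj h0 (pr_ne_top _ _)).1 h1
  rw [← h3, ENNReal.toReal_ofReal (condProb_nonneg _ _ _)]

/-- The probability of `f_{-1}` from the state of level `ℓ` and offset `b`. -/
noncomputable def hitProb (ℓ : ℕ) (b : ℤ) : ℝ≥0∞ := coinSum ε (rem ℓ) (-1 - b)

/-- The probability of a nonnegative final sum from the state of level `ℓ` and offset `b`. -/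
noncomputable def posProb (ℓ : ℕ) (b : ℤ) : ℝ≥0∞ := pr (coinSum ε (rem ℓ)) {x | 0 ≤ b + x}

theorem posProb_succ (ℓ : ℕ) (b : ℤ) :
    posProb ε (ℓ + 1) b = eexp (coinSum ε ((ℓ + 1) ^ 2)) fun d => posProb ε ℓ (b + d) := by
  rw [posProb, rem_succ, pr, eexp_coinSum_add]
  refine eexp_congr fun d _ => eexp_congr fun x _ => ?_
  simp only [Set.indicator_apply, Set.mem_ofPred_eq, add_assoc, Pi.one_apply]

theorem hitProb_eq_eexp (ℓ : ℕ) (b : ℤ) :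
    hitProb ε ℓ b = eexp (coinSum ε (rem ℓ)) fun x => ({-1} : Set ℤ).indicator 1 (b + x) := by
  rw [hitProb, ← pr_singleton, pr]
  refine eexp_congr fun x _ => ?_
  have : x = -1 - b ↔ b + x = -1 := by omega
  simp only [Set.indicator_apply, Set.mem_singleton_iff, this, Pi.one_apply]

theorem hitProb_succ (ℓ : ℕ) (b : ℤ) :
    hitProb ε (ℓ + 1) b = eexp (coinSum ε ((ℓ + 1) ^ 2)) fun d => hitProb ε ℓ (b + d) := by
  simp only [hitProb_eq_eexp]
  rw [rem_succ, eexp_coinSum_add]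
  simp only [add_assoc]

theorem cVal_eq {j : Fin m} {b : ℤ} (h0 : pr (game m ε f) (noHint j b) ≠ 0) :
    cVal m ε f j b = (posProb ε (level j) b).toReal :=
  condProb_noHint ε f h0 (Set.Ici 0)

theorem condProb_finalState_eq {j : Fin m} {b : ℤ} (h0 : pr (game m ε f) (noHint j b) ≠ 0) :
    condProb (game m ε f) (finalState m (-1)) (noHint j b) =
      (hitProb ε (level j) b).toReal := by
  rw [hitProb, ← pr_singleton]
  refine (condProb_noHint ε f h0 {-1}).trans ?_
  congr 2
  ext x
  have : x = -1 - b ↔ b + x = -1 := by omega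
  simp [this]

/-- The hint may reveal anything about the coins of its own round, but the later rounds remain
fresh. So the value is an average of `posProb` one level lower. -/
theorem ofReal_vVal_mul (j : Fin m) (b : ℤ) (h : H) :
    ENNReal.ofReal (vVal m ε f j b h) * pr (game m ε f) (withHint j b h) =
      eexp (game m ε f) (fun ω => (withHint j b h).indicator 1 ω *
        posProb ε (level j - 1) (b + (ω j).1)) := by
  rw [vVal, ofReal_condProb_mul]
  have e1 : pr (game m ε f) (finalPos m ∩ withHint j b h) =
      eexp (game m ε f) (fun ω => (withHint j b h).indicator 1 ω *
        (Set.Ici (0 : ℤ)).indicator 1 (partialSum ω m)) := by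
    refine eexp_congr fun ω _ => ?_
    have g3 : ω ∈ finalPos m ↔ partialSum ω m ∈ Set.Ici (0 : ℤ) := Iff.rfl
    by_cases g1 : ω ∈ withHint j b h <;> by_cases g2 : partialSum ω m ∈ Set.Ici (0 : ℤ) <;>
      simp [g1, g2, g3]
  rw [e1, eexp_game_mul ε f (show (j : ℕ) + 1 ≤ m from j.2) (dependsOn_indicator_withHint j b h)]
  refine eexp_congr fun ω _ => ?_
  by_cases g1 : ω ∈ withHint j b h
  · have g2 : partialSum ω j = b := g1.1
    rw [partialSum_succ, g2, Nat.sub_succ']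
    rfl
  · simp [g1]

theorem coinSum_ne_zero_of_game {ω : Fin m → ℤ × H} (hω : game m ε f ω ≠ 0) (i : Fin m) :
    coinSum ε (level i ^ 2) (ω i).1 ≠ 0 := by
  intro h0
  have h := eexp_game_mul_coin ε f i (φ := fun _ => 1) (fun _ _ _ => rfl)
    (({(ω i).1} : Set ℤ).indicator 1)
  have h1 : eexp (coinSum ε (level i ^ 2)) (({(ω i).1} : Set ℤ).indicator 1) = 0 :=
    (pr_singleton _ _).trans h0
  rw [h1, mul_zero] at h
  let E : Set (Fin m → ℤ × H) := {ω' | (ω' i).1 = (ω i).1}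
  have hE : ω ∈ E := rfl
  refine pr_pos_of_mem hω hE (Eq.trans ?_ h)
  refine eexp_congr fun ω' _ => ?_
  simp only [E, Set.indicator_apply, Set.mem_ofPred_eq, Set.mem_singleton_iff, Pi.one_apply,
    one_mul]

/-- The sum of the coins before round `j + 1` has the parity of their number. -/
theorem partialSum_parity {ω : Fin m → ℤ × H} (hω : game m ε f ω ≠ 0) (j : Fin m)
    (hm : Odd (rem m)) : partialSum ω j + 1 ≡ rem (level j) [ZMOD 2] := by
  -- The parity of `S_k + rem (m - k)` is invariant, since a sum of `n` coins is congruent to `n`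
  -- modulo 2.
  have hsum (k : ℕ) (hk : k ≤ m) : ∃ t : ℤ, partialSum ω k + rem (m - k) = rem m + 2 * t := by
    induction k with
    | zero => exact ⟨0, by simp [partialSum]⟩
    | succ k ih =>
      obtain ⟨t, ht⟩ := ih (by omega)
      obtain ⟨i, _, hi⟩ := exists_eq_of_coinSum_ne_zero ε (coinSum_ne_zero_of_game ε f hω ⟨k, hk⟩)
      have h1 := partialSum_succ ω ⟨k, hk⟩
      have h2 : rem (m - k) = (m - k) ^ 2 + rem (m - (k + 1)) := by
        obtain ⟨d, hd⟩ := Nat.exists_eq_add_of_lt (show k < m from hk)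
        have e1 : m - k = d + 1 := by omega
        have e2 : m - (k + 1) = d := by omega
        rw [e1, e2, rem_succ]
      simp only [level] at h1 hi
      rw [h2] at ht
      rw [h1]
      push_cast at ht hi ⊢
      exact ⟨t + i - ((m - k : ℕ) : ℤ) ^ 2, by linarith⟩
  obtain ⟨t, ht⟩ := hsum j j.2.le
  obtain ⟨s, hs⟩ := hm
  rw [hs] at ht
  push_cast at ht
  have e : ((rem (level j) : ℕ) : ℤ) = rem (m - j) := rfl
  rw [e]
  exact (Int.emod_emod_of_dvd _ (dvd_refl 2)).symm.trans (by omega)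

end Game

/-! ### The stopping round of a player. -/

section Player

variable {H : Type*} {m : ℕ} (ε : Set.Icc (-1 : ℝ) 1) (f : ℕ → ℤ → ℤ → PMF H) (B : Player H)

theorem history_congr {ω ω' : Fin m → ℤ × H} {j : Fin m}
    (h : ∀ i : Fin m, (i : ℕ) < (j : ℕ) + 1 → ω i = ω' i) : history ω j = history ω' j := by
  refine List.ext_getElem (by simp [history]) fun i h1 h2 => ?_
  have h3 : i < (j : ℕ) + 1 := by simp [history] at h1; omega
  have h4 : i < m := by simp [history] at h1; omega
  simp only [history, List.getElem_take, List.getElem_ofFn]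
  rw [h ⟨i, h4⟩ h3, partialSum_congr fun i' hi' => h i' (lt_trans hi' h3)]

theorem firstOne_cons_apply (ω : Fin m → ℤ × H) (j0 j : Fin m) (js : List (Fin m)) :
    firstOne B ω (j0 :: js) (some j) = B (history ω j0) true * (if j = j0 then 1 else 0) +
      B (history ω j0) false * firstOne B ω js (some j) := by
  rw [firstOne, PMF.bind_apply, tsum_fintype, Fintype.sum_bool]
  simp [PMF.pure_apply]

theorem firstOne_eq_zero (ω : Fin m → ℤ × H) {j : Fin m} {l : List (Fin m)} (h : j ∉ l) :
    firstOne B ω l (some j) = 0 := by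
  induction l with
  | nil => simp [firstOne, PMF.pure_apply]
  | cons j0 js ih =>
    rw [List.mem_cons, not_or] at h
    rw [firstOne_cons_apply, ih h.2, if_neg h.1]
    simp

/-- Stopping is decided by the inputs received so far: rounds listed after `j` cannot produce the
value `j`, because the list increases. -/
theorem firstOne_congr {ω ω' : Fin m → ℤ × H} {j : Fin m}
    (h : ∀ i : Fin m, (i : ℕ) < (j : ℕ) + 1 → ω i = ω' i) {l : List (Fin m)}
    (hl : l.Pairwise (· < ·)) : firstOne B ω l (some j) = firstOne B ω' l (some j) := by
  induction l with
  | nil => rfl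
  | cons j0 js ih =>
    rw [List.pairwise_cons] at hl
    rcases le_or_gt j0 j with h1 | h1
    · rw [firstOne_cons_apply, firstOne_cons_apply, ih hl.2,
        history_congr fun i hi => h i (lt_of_lt_of_le hi (by simpa using h1))]
    · have : j ∉ j0 :: js := by
        rw [List.mem_cons, not_or]
        exact ⟨h1.ne, fun hj => absurd (hl.1 j hj) (not_lt.2 h1.le)⟩
      rw [firstOne_eq_zero B ω this, firstOne_eq_zero B ω' this]

/-- The probability that the player first outputs `1` in round `j + 1` of the run `ω`. -/
noncomputable def stopProb (ω : Fin m → ℤ × H) (j : Fin m) : ℝ≥0∞ :=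
  firstOne B ω (List.finRange m) (some j)

theorem dependsOn_stopProb (j : Fin m) :
    DependsOn (fun ω : Fin m → ℤ × H => stopProb B ω j) {i | (i : ℕ) < (j : ℕ) + 1} :=
  fun _ _ h => firstOne_congr B h (List.pairwise_lt_finRange m)

theorem stopProb_le_one (ω : Fin m → ℤ × H) (j : Fin m) : stopProb B ω j ≤ 1 :=
  PMF.coe_le_one _ _

theorem sum_stopProb_le_one (ω : Fin m → ℤ × H) : ∑ j, stopProb B ω j ≤ 1 := by
  have h := (firstOne B ω (List.finRange m)).tsum_coe
  rw [tsum_fintype, Fintype.sum_option] at h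
  exact le_trans le_add_self h.le

/-- The value `none` may be given weight 0, since the two outcomes agree when the player never
stops. -/
theorem eexp_play (U : (Fin m → ℤ × H) → Fin m → ℝ≥0∞) :
    eexp (play m ε f B) (fun x => x.2.elim 0 (U x.1)) =
      ∑ j, eexp (game m ε f) fun ω => stopProb B ω j * U ω j := by
  rw [play, eexp_bind, ← eexp_sum]
  refine eexp_congr fun ω _ => ?_
  rw [eexp_map, eexp, tsum_fintype, Fintype.sum_option]
  simp [stopProb]

theorem game_ne_zero_of_play {x : (Fin m → ℤ × H) × Option (Fin m)}
    (hx : play m ε f B x ≠ 0) : game m ε f x.1 ≠ 0 := by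
  have : x ∈ (play m ε f B).support := hx
  rw [play, PMF.mem_support_bind_iff] at this
  obtain ⟨ω, hω, h⟩ := this
  rw [PMF.support_map] at h
  obtain ⟨I, _, rfl⟩ := h
  exact hω

/-- A pointwise bound on the gain in each round bounds the total gain. -/
theorem signedBias_le {K : ℝ} (hK : 0 ≤ K) (U : (Fin m → ℤ × H) → Fin m → ℝ≥0∞)
    (h : ∀ ω, game m ε f ω ≠ 0 → ∀ j, ENNReal.ofReal (cVal m ε f j (partialSum ω j) -
      vVal m ε f j (partialSum ω j) (ω j).2) ≤ U ω j)
    (hU : ∑ j, eexp (game m ε f) (fun ω => stopProb B ω j * U ω j) ≤ ENNReal.ofReal K) :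
    signedBias m ε f B ≤ K := by
  refine expect_le_of_eexp_le (U := fun x => x.2.elim 0 (U x.1)) hK ?_ ?_
  · rintro ⟨ω, I⟩ hx
    cases I with
    | none => simp [outcome, outcomeMinus]
    | some j => exact h ω (game_ne_zero_of_play ε f B hx) j
  · rw [eexp_play]
    exact hU

theorem neg_signedBias_le {K : ℝ} (hK : 0 ≤ K) (U : (Fin m → ℤ × H) → Fin m → ℝ≥0∞)
    (h : ∀ ω, game m ε f ω ≠ 0 → ∀ j, ENNReal.ofReal (-(cVal m ε f j (partialSum ω j) -
      vVal m ε f j (partialSum ω j) (ω j).2)) ≤ U ω j)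
    (hU : ∑ j, eexp (game m ε f) (fun ω => stopProb B ω j * U ω j) ≤ ENNReal.ofReal K) :
    -signedBias m ε f B ≤ K := by
  have e : -signedBias m ε f B = expect (play m ε f B) fun x =>
      -(outcomeMinus m ε f x.1 x.2 - outcome m ε f x.1 x.2) := by
    rw [signedBias, expect, expect, ← tsum_neg]
    exact tsum_congr fun x => by ring
  rw [e]
  refine expect_le_of_eexp_le (U := fun x => x.2.elim 0 (U x.1)) hK ?_ ?_
  · rintro ⟨ω, I⟩ hx
    cases I with
    | none => simp [outcome, outcomeMinus]
    | some j => exact h ω (game_ne_zero_of_play ε f B hx) j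
  · rw [eexp_play]
    exact hU

end Player

/-! ### The number of remaining coins is of cubic order. -/

theorem rem_le (ℓ : ℕ) : rem ℓ ≤ ℓ ^ 3 := by
  rw [rem]
  calc ∑ k ∈ Finset.Icc 1 ℓ, k ^ 2 ≤ ∑ _k ∈ Finset.Icc 1 ℓ, ℓ ^ 2 :=
        Finset.sum_le_sum fun k hk => Nat.pow_le_pow_left (Finset.mem_Icc.1 hk).2 2
    _ = ℓ ^ 3 := by rw [Finset.sum_const, Nat.card_Icc]; simp; ring

theorem le_three_mul_rem (ℓ : ℕ) : ℓ ^ 3 ≤ 3 * rem ℓ := by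
  induction ℓ with
  | zero => simp
  | succ ℓ ih => rw [rem_succ]; nlinarith

/-! ### Estimates within one round. -/

section Level

variable (ε : Set.Icc (-1 : ℝ) 1) (L : ℝ)

/-- The offset `b` at level `ℓ` is close to its centre. -/
def Window (ℓ : ℕ) (b : ℤ) : Prop := |(b : ℝ) + ε * rem ℓ| ≤ 4 * √(L * rem ℓ)

/-- The sums of `n` coins that are far from the mean. -/
def deviant (n : ℕ) : Set ℤ := {x | 4 * √(L * n) < |(x : ℝ) - ε * n|}

/-- The bound on the probability of a deviant sum. -/
noncomputable def tailBound : ℝ≥0∞ := ENNReal.ofReal (2 * Real.exp (-8 * L))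

theorem pr_deviant_le (hL : 0 ≤ L) (n : ℕ) : pr (coinSum ε n) (deviant ε L n) ≤ tailBound L :=
  pr_deviation_le ε n hL

theorem tailBound_le_half (hL : 1 ≤ L) : 2 * tailBound L ≤ 1 := by
  rw [tailBound, ← ENNReal.ofReal_ofNat, ← ENNReal.ofReal_mul (by norm_num), ENNReal.ofReal_le_one]
  have h1 : Real.exp (-8 * L) * Real.exp (8 * L) = 1 := by rw [← Real.exp_add]; simp
  have h2 := Real.add_one_le_exp (8 * L)
  nlinarith [Real.exp_pos (-8 * L)]

/-- The expected final sum is `b + ε · rem ℓ`. Outside the window, the final sum can have the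
opposite sign only through a deviant sum of the remaining coins. -/
theorem pr_final_small_of_not_window (hL : 0 ≤ L) {ℓ : ℕ} {b : ℤ} (hb : ¬ Window ε L ℓ b) :
    posProb ε ℓ b ≤ tailBound L ∨ pr (coinSum ε (rem ℓ)) {x | 0 ≤ b + x}ᶜ ≤ tailBound L := by
  rw [Window, not_le] at hb
  rcases lt_abs.1 hb with h | h
  · right
    refine le_trans (pr_mono _ fun x hx => ?_) (pr_deviant_le ε L hL (rem ℓ))
    have hx' : b + x < 0 := not_le.1 hx
    have hx'' : (b : ℝ) + x < 0 := by exact_mod_cast hx'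
    exact lt_of_lt_of_le (show _ < -((x : ℝ) - ε * rem ℓ) by linarith) (neg_le_abs _)
  · left
    refine le_trans (pr_mono _ fun x hx => ?_) (pr_deviant_le ε L hL (rem ℓ))
    have hx' : 0 ≤ b + x := hx
    have hx'' : (0 : ℝ) ≤ (b : ℝ) + x := by exact_mod_cast hx'
    exact lt_of_lt_of_le (show _ < ((x : ℝ) - ε * rem ℓ) by linarith) (le_abs_self _)

theorem pr_final_far_of_window (hL : 0 ≤ L) {ℓ : ℕ} {b : ℤ} (hb : Window ε L ℓ b) {w : ℝ}
    (hw : 8 * √(L * rem ℓ) ≤ w) :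
    pr (coinSum ε (rem ℓ)) {x | w < |((b + x : ℤ) : ℝ)|} ≤ tailBound L := by
  refine le_trans (pr_mono _ fun x hx => ?_) (pr_deviant_le ε L hL (rem ℓ))
  have hx' : w < |((b + x : ℤ) : ℝ)| := hx
  have h1 := abs_add_le ((b : ℝ) + ε * rem ℓ) ((x : ℝ) - ε * rem ℓ)
  have e : (b : ℝ) + ε * rem ℓ + ((x : ℝ) - ε * rem ℓ) = ((b + x : ℤ) : ℝ) := by push_cast; ring
  rw [e] at h1
  have hb' : |(b : ℝ) + ε * rem ℓ| ≤ 4 * √(L * rem ℓ) := hb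
  show 4 * √(L * rem ℓ) < |(x : ℝ) - ε * rem ℓ|
  linarith

variable {ε L} {k : ℕ} {b : ℤ}

theorem hitProb_le_one (ℓ : ℕ) (b : ℤ) : hitProb ε ℓ b ≤ 1 := PMF.coe_le_one _ _

theorem posProb_le_one (ℓ : ℕ) (b : ℤ) : posProb ε ℓ b ≤ 1 := pr_le_one _ _

/-- The hypotheses under which the estimates at level `k + 1` hold. -/
structure GoodLevel (ε : Set.Icc (-1 : ℝ) 1) (L : ℝ) (k : ℕ) : Prop where
  one_le : 1 ≤ L
  -- The 7 comes from `4√3 < 7` and `rem m ≥ ℓ³/3`; see `abs_bias_le`.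
  bias_le : |(ε : ℝ)| ≤ 7 * √L / √((k + 1 : ℕ) : ℝ) ^ 3
  -- The constant exceeds `24596 = 2236 · 11`, which arises in `hitProb_ratio`.
  large : 25000 * L ≤ √((k + 1 : ℕ) : ℝ)

/-- The 11 is 4 from the deviation plus 7 from the drift `|ε| ℓ² ≤ 7 √ℓ √L`. -/
theorem abs_le_of_not_deviant (h : GoodLevel ε L k) {d : ℤ} (hd : d ∉ deviant ε L ((k + 1) ^ 2)) :
    |(d : ℝ)| ≤ 11 * (k + 1 : ℕ) * √L := by
  have hd' : |(d : ℝ) - ε * ((k + 1) ^ 2 : ℕ)| ≤ 4 * √(L * ((k + 1) ^ 2 : ℕ)) := not_lt.1 hd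
  have hL := h.one_le
  have hε := h.bias_le
  have hz := h.large
  set z := √((k + 1 : ℕ) : ℝ) with hzdef
  set y := √L with hydef
  have hz2 : ((k + 1 : ℕ) : ℝ) = z ^ 2 := (Real.sq_sqrt (by positivity)).symm
  have hy2 : L = y ^ 2 := (Real.sq_sqrt (by linarith)).symm
  have hz1 : 1 ≤ z := by linarith
  have hy0 : 0 ≤ y := Real.sqrt_nonneg _
  push_cast at hd'
  have e : ((k : ℝ) + 1) = z ^ 2 := by rw [← hz2]; push_cast; ring
  have hs : √(L * ((k : ℝ) + 1) ^ 2) = y * z ^ 2 := by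
    rw [Real.sqrt_mul (by linarith), Real.sqrt_sq (by positivity), e]
  rw [hs, e] at hd'
  rw [hz2]
  have h1 : |(ε : ℝ) * (z ^ 2) ^ 2| ≤ 7 * y * z := by
    rw [abs_mul, abs_of_nonneg (by positivity : (0 : ℝ) ≤ (z ^ 2) ^ 2)]
    calc |(ε : ℝ)| * (z ^ 2) ^ 2 ≤ 7 * y / z ^ 3 * (z ^ 2) ^ 2 := by gcongr
      _ = 7 * y * z := by field_simp
  have h2 := abs_add_le ((d : ℝ) - ε * (z ^ 2) ^ 2) (ε * (z ^ 2) ^ 2)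
  rw [sub_add_cancel] at h2
  nlinarith [mul_nonneg hy0 (sub_nonneg.2 hz1), mul_nonneg (mul_nonneg hy0 (by linarith : 0 ≤ z))
    (sub_nonneg.2 hz1)]

/-- Let `ℓ = k + 1`. The shift takes `O(ℓ √L)` steps, and each changes the mass function by a
relative `O(√L / ℓ^(3/2))`. The product is `O(L / √ℓ)`, which `GoodLevel` makes small. Only `y`
needs the right parity: for `x` of the wrong parity the left side is 0. -/
theorem hitProb_ratio (h : GoodLevel ε L k) (hb : Window ε L (k + 1) b)
    (hpar : b + 1 ≡ rem (k + 1) [ZMOD 2]) {x y : ℤ} (hx : |(x : ℝ)| ≤ 11 * (k + 1 : ℕ) * √L)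
    (hy : |(y : ℝ)| ≤ 11 * (k + 1 : ℕ) * √L) (hyp : y ≡ ((k + 1) ^ 2 : ℕ) [ZMOD 2]) :
    hitProb ε k (b + x) ≤ 3 * hitProb ε k (b + y) := by
  by_cases h0 : hitProb ε k (b + x) = 0
  · rw [h0]; exact zero_le
  obtain ⟨i, _, hi⟩ := exists_eq_of_coinSum_ne_zero ε h0
  have hpar1 : -1 - (b + x) ≡ rem k [ZMOD 2] := by
    rw [hi]
    exact (Int.emod_emod_of_dvd _ (dvd_refl 2)).symm.trans (by omega)
  have hpar2 : -1 - (b + y) ≡ rem k [ZMOD 2] := by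
    rw [rem_succ, Nat.cast_add] at hpar
    have h1 : (2 : ℤ) ∣ _ := hpar.dvd
    have h2 : (2 : ℤ) ∣ _ := hyp.dvd
    refine Int.modEq_iff_dvd.2 ?_
    omega
  have hL := h.one_le
  have hε := h.bias_le
  have hz := h.large
  have hb' : |(b : ℝ) + ε * rem (k + 1)| ≤ 4 * √(L * rem (k + 1)) := hb
  set z := √((k + 1 : ℕ) : ℝ) with hzdef
  set v := √L with hvdef
  have hz2 : ((k + 1 : ℕ) : ℝ) = z ^ 2 := (Real.sq_sqrt (by positivity)).symm
  have hv2 : L = v ^ 2 := (Real.sq_sqrt (by linarith)).symm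
  have hz1 : 25000 ≤ z := by linarith
  have hv0 : 0 ≤ v := Real.sqrt_nonneg _
  have hv1 : 1 ≤ v := by rw [hvdef]; exact Real.one_le_sqrt.2 hL
  have hzv : 25000 * v ^ 2 ≤ z := by rw [← hv2]; exact hz
  have hr1 : (rem (k + 1) : ℝ) ≤ z ^ 6 := by
    calc (rem (k + 1) : ℝ) ≤ ((k + 1 : ℕ) : ℝ) ^ 3 := by exact_mod_cast rem_le (k + 1)
      _ = z ^ 6 := by rw [hz2]; ring
  have hr2 : z ^ 6 / 24 ≤ (rem k : ℝ) := by
    have h3 : (k : ℝ) ^ 3 ≤ 3 * rem k := by exact_mod_cast le_three_mul_rem k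
    have h4 : z ^ 2 / 2 ≤ k := by
      have : (k : ℝ) = z ^ 2 - 1 := by rw [← hz2]; push_cast; ring
      rw [this]; nlinarith
    have h5 : (z ^ 2 / 2) ^ 3 ≤ (k : ℝ) ^ 3 := by gcongr
    have h6 : (z ^ 2 / 2) ^ 3 = z ^ 6 / 8 := by ring
    linarith
  have hz3 : 0 < z ^ 3 := by positivity
  have hbb : |(b : ℝ)| ≤ 11 * v * z ^ 3 := by
    have h1 : √(L * rem (k + 1)) ≤ v * z ^ 3 := by
      rw [Real.sqrt_mul (by linarith)]
      gcongr
      refine Real.sqrt_le_iff.2 ⟨by positivity, hr1.trans_eq (by ring)⟩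
    have h2 : |(ε : ℝ) * rem (k + 1)| ≤ 7 * v * z ^ 3 := by
      rw [abs_mul, abs_of_nonneg (by positivity : (0 : ℝ) ≤ rem (k + 1))]
      calc |(ε : ℝ)| * rem (k + 1) ≤ 7 * v / z ^ 3 * z ^ 6 := by gcongr
        _ = 7 * v * z ^ 3 := by field_simp
    have h3 := abs_sub ((b : ℝ) + ε * rem (k + 1)) (ε * rem (k + 1))
    rw [add_sub_cancel_right] at h3
    linarith
  rw [hz2] at hx hy
  have hvz : v * z ^ 2 ≤ v * z ^ 3 := by
    gcongr
    · linarith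
    · norm_num
  have h1vz : 1 ≤ v * z ^ 3 := by
    have : 1 ≤ z ^ 3 := one_le_pow₀ (by linarith)
    nlinarith
  -- The constant is `23 = 11 + 11 + 1`, from `b`, `t` and the target `-1`.
  have hbound (t : ℤ) (ht : |(t : ℝ)| ≤ 11 * z ^ 2 * v) :
      |((-1 - (b + t) : ℤ) : ℝ)| ≤ 23 * v * z ^ 3 := by
    push_cast
    rw [abs_le] at ht hbb ⊢
    constructor <;> linarith
  have hn0 : (0 : ℝ) < rem k := lt_of_lt_of_le (by positivity) hr2
  -- Since `rem k ≥ z⁶/24`, the relative width is `23 · 24 = 552` times `v/z³`, whence `2236 = 4(552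
  -- + 7)`.
  have key := coinSum_ratio ε (n := rem k) (a := -1 - (b + x)) (b := -1 - (b + y))
    (w := 23 * v * z ^ 3) (e := 7 * v / z ^ 3) (θ := 2236 * v / z ^ 3) (N := 11 * v * z ^ 2)
    (by exact_mod_cast hn0) hpar1 hpar2 (hbound x hx) (hbound y hy)
    (by
      have h1 : 2208 * v ≤ z ^ 3 := by
        have : z ≤ z ^ 3 := le_self_pow₀ (by linarith) (by norm_num)
        nlinarith
      have h2 : 2208 * v * z ^ 3 ≤ z ^ 3 * z ^ 3 := by gcongr
      have h3 : z ^ 3 * z ^ 3 = z ^ 6 := by ring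
      linarith)
    hε
    (by
      rw [div_le_iff₀ hz3]
      have : z ≤ z ^ 3 := le_self_pow₀ (by linarith) (by norm_num)
      nlinarith)
    (by
      have h1 : 23 * v * z ^ 3 / rem k ≤ 23 * v * z ^ 3 / (z ^ 6 / 24) := by gcongr
      have h2 : 23 * v * z ^ 3 / (z ^ 6 / 24) = 552 * v / z ^ 3 := by field_simp; norm_num
      have h3 : 4 * (552 * v / z ^ 3 + 7 * v / z ^ 3) = 2236 * v / z ^ 3 := by ring
      linarith)
    (by
      push_cast
      rw [abs_le] at hx hy ⊢
      constructor <;> linarith)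
    (by
      have : 2236 * v / z ^ 3 * (11 * v * z ^ 2) = 24596 * v ^ 2 / z := by field_simp; norm_num
      rw [this, div_le_one (by linarith)]
      nlinarith)
  rw [hitProb, hitProb, ← ENNReal.toReal_le_toReal (PMF.apply_ne_top _ _)
    (ENNReal.mul_ne_top (by norm_num) (PMF.apply_ne_top _ _)), ENNReal.toReal_mul]
  simpa using key

theorem modEq_of_coinSum_ne_zero {n : ℕ} {d : ℤ} (h : coinSum ε n d ≠ 0) : d ≡ n [ZMOD 2] := by
  obtain ⟨i, _, rfl⟩ := exists_eq_of_coinSum_ne_zero ε h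
  exact Int.modEq_iff_dvd.2 (by omega)

/-- Averages over the coins of a round, up to the deviant ones. -/
theorem le_eexp_coinSum_add (hL : 0 ≤ L) {n : ℕ} {A c : ℝ≥0∞} {g : ℤ → ℝ≥0∞} (hA : A ≤ 1)
    (hg : ∀ d, coinSum ε n d ≠ 0 → d ∉ deviant ε L n → A ≤ g d + c) :
    A ≤ eexp (coinSum ε n) g + c + tailBound L := by
  calc A = eexp (coinSum ε n) (fun _ => A) := (eexp_const _ _).symm
    _ ≤ eexp (coinSum ε n) (fun d => (g d + c) + (deviant ε L n).indicator 1 d) := by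
        refine eexp_mono fun d hd => ?_
        by_cases h : d ∈ deviant ε L n
        · rw [Set.indicator_of_mem h]; exact hA.trans le_add_self
        · exact (hg d hd h).trans le_self_add
    _ = eexp (coinSum ε n) g + c + pr (coinSum ε n) (deviant ε L n) := by
        rw [eexp_add, eexp_add, eexp_const]; rfl
    _ ≤ _ := by gcongr; exact pr_deviant_le ε L hL n

theorem eexp_coinSum_le_add (hL : 0 ≤ L) {n : ℕ} {A : ℝ≥0∞} {g : ℤ → ℝ≥0∞} (hg1 : ∀ d, g d ≤ 1)
    (hg : ∀ d, coinSum ε n d ≠ 0 → d ∉ deviant ε L n → g d ≤ A) :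
    eexp (coinSum ε n) g ≤ A + tailBound L := by
  calc eexp (coinSum ε n) g ≤ eexp (coinSum ε n) (fun d => A + (deviant ε L n).indicator 1 d) := by
        refine eexp_mono fun d hd => ?_
        by_cases h : d ∈ deviant ε L n
        · rw [Set.indicator_of_mem h]; exact (hg1 d).trans le_add_self
        · exact (hg d hd h).trans le_self_add
    _ = A + pr (coinSum ε n) (deviant ε L n) := by
        rw [eexp_add, eexp_const]; rfl
    _ ≤ _ := by gcongr; exact pr_deviant_le ε L hL n

/-- The left side averages the hitting probability over the coins of the round, and typical terms
agree up to a factor 3. The bound holds for each single `d`, so it survives a stopping rule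
correlated with the coins through the hint. -/
theorem hitProb_succ_le (h : GoodLevel ε L k) (hb : Window ε L (k + 1) b)
    (hpar : b + 1 ≡ rem (k + 1) [ZMOD 2]) {d : ℤ} (hd0 : coinSum ε ((k + 1) ^ 2) d ≠ 0)
    (hd : d ∉ deviant ε L ((k + 1) ^ 2)) :
    hitProb ε (k + 1) b ≤ 3 * hitProb ε k (b + d) + tailBound L := by
  rw [hitProb_succ]
  refine eexp_coinSum_le_add (by linarith [h.one_le]) (fun _ => hitProb_le_one _ _)
    fun d' _ hd' => ?_
  exact hitProb_ratio h hb hpar (abs_le_of_not_deviant h hd') (abs_le_of_not_deviant h hd)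
    (modEq_of_coinSum_ne_zero hd0)

/-- Non-deviant coins have mass at least `1/2`, so the average loses at most a factor 2 beyond the 3
of `hitProb_ratio`; there is no additive error. -/
theorem hitProb_le_succ (h : GoodLevel ε L k) (hb : Window ε L (k + 1) b)
    (hpar : b + 1 ≡ rem (k + 1) [ZMOD 2]) {x : ℤ} (hx : |(x : ℝ)| ≤ 11 * (k + 1 : ℕ) * √L) :
    hitProb ε k (b + x) ≤ 6 * hitProb ε (k + 1) b := by
  set p := coinSum ε ((k + 1) ^ 2)
  set D := deviant ε L ((k + 1) ^ 2)
  have h1 : 1 ≤ 2 * pr p Dᶜ := by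
    have h2 : 2 * pr p D ≤ 1 := le_trans (by gcongr; exact pr_deviant_le ε L (by linarith [h.one_le]) _)
      (tailBound_le_half L h.one_le)
    have h3 : 2 * pr p D + 2 * pr p Dᶜ = 2 := by rw [← mul_add, pr_add_compl, mul_one]
    by_contra h4
    rw [not_le] at h4
    have h5 := ENNReal.add_lt_add_of_le_of_lt (ne_top_of_le_ne_top ENNReal.one_ne_top h2) h2 h4
    rw [h3] at h5
    exact absurd h5 (by norm_num)
  have h2 : pr p Dᶜ * hitProb ε k (b + x) ≤ 3 * hitProb ε (k + 1) b := by
    rw [hitProb_succ, pr, ← eexp_mul_const, ← eexp_const_mul]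
    refine eexp_mono fun d hd0 => ?_
    by_cases hd : d ∈ D
    · rw [Set.indicator_of_notMem (Set.notMem_compl_iff.2 hd), zero_mul]
      exact zero_le
    · rw [Set.indicator_of_mem (show d ∈ Dᶜ from hd), Pi.one_apply, one_mul]
      exact hitProb_ratio h hb hpar hx (abs_le_of_not_deviant h hd) (modEq_of_coinSum_ne_zero hd0)
  calc hitProb ε k (b + x) ≤ (2 * pr p Dᶜ) * hitProb ε k (b + x) := le_mul_of_one_le_left' h1
    _ = 2 * (pr p Dᶜ * hitProb ε k (b + x)) := by ring
    _ ≤ 2 * (3 * hitProb ε (k + 1) b) := by gcongr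
    _ = 6 * hitProb ε (k + 1) b := by rw [← mul_assoc]; norm_num

/-- If the sum started from `b + d` ends nonnegative and the one from `b + d'` does not, then an
intermediate start `b + t` ends exactly at `-1`. -/
theorem posProb_le_add_sum {d d' : ℤ} :
    posProb ε k (b + d) ≤ posProb ε k (b + d') + ∑ t ∈ Finset.Ico d' d, hitProb ε k (b + t) := by
  have h1 (t : ℤ) : hitProb ε k (b + t) = pr (coinSum ε (rem k)) {-1 - (b + t)} :=
    (pr_singleton _ _).symm
  simp only [posProb, h1]
  simp only [pr]
  rw [← eexp_sum, ← eexp_add]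
  refine eexp_mono fun x _ => ?_
  by_cases g1 : 0 ≤ b + d + x
  · by_cases g2 : 0 ≤ b + d' + x
    · refine le_trans ?_ le_self_add
      rw [Set.indicator_of_mem (by exact g1), Set.indicator_of_mem (by exact g2)]
    · refine le_trans ?_ le_add_self
      refine le_trans ?_ (Finset.single_le_sum (f := fun t : ℤ =>
        ({-1 - (b + t)} : Set ℤ).indicator (1 : ℤ → ℝ≥0∞) x) (fun _ _ => zero_le)
        (Finset.mem_Ico.2 (⟨by omega, by omega⟩ : d' ≤ -1 - b - x ∧ -1 - b - x < d)))
      have : x ∈ ({-1 - (b + (-1 - b - x))} : Set ℤ) := by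
        rw [Set.mem_singleton_iff]; ring
      rw [Set.indicator_of_mem (by exact g1), Set.indicator_of_mem this]
  · rw [Set.indicator_of_notMem (by exact g1)]
    exact zero_le

/-- The bound on the effect of the coins of a round of level `ℓ` on the value. -/
noncomputable def roundChange (ε : Set.Icc (-1 : ℝ) 1) (L : ℝ) (ℓ : ℕ) (b : ℤ) : ℝ≥0∞ :=
  ENNReal.ofReal (132 * ℓ * √L) * hitProb ε ℓ b

/-- At most `22 ℓ √L` shifts separate two typical sums, where `ℓ = k + 1`, and each costs `6 *
hitProb`; hence the 132 in `roundChange`. -/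
theorem posProb_le_add (h : GoodLevel ε L k) (hb : Window ε L (k + 1) b)
    (hpar : b + 1 ≡ rem (k + 1) [ZMOD 2]) {d d' : ℤ} (hd : d ∉ deviant ε L ((k + 1) ^ 2))
    (hd' : d' ∉ deviant ε L ((k + 1) ^ 2)) :
    posProb ε k (b + d) ≤ posProb ε k (b + d') + roundChange ε L (k + 1) b := by
  have h1 := abs_le.1 (abs_le_of_not_deviant h hd)
  have h2 := abs_le.1 (abs_le_of_not_deviant h hd')
  refine (posProb_le_add_sum (d' := d')).trans (add_le_add le_rfl ?_)
  calc ∑ t ∈ Finset.Ico d' d, hitProb ε k (b + t)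
      ≤ ∑ _t ∈ Finset.Ico d' d, 6 * hitProb ε (k + 1) b := by
        refine Finset.sum_le_sum fun t ht => hitProb_le_succ h hb hpar ?_
        obtain ⟨g1, g2⟩ := Finset.mem_Ico.1 ht
        have g1' : (d' : ℝ) ≤ t := by exact_mod_cast g1
        have g2' : (t : ℝ) < d := by exact_mod_cast g2
        exact abs_le.2 ⟨by linarith, by linarith⟩
    _ = ENNReal.ofReal (6 * (d - d').toNat) * hitProb ε (k + 1) b := by
        rw [Finset.sum_const, Int.card_Ico, nsmul_eq_mul, ENNReal.ofReal_mul (by norm_num),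
          ENNReal.ofReal_natCast, ENNReal.ofReal_ofNat]
        ring
    _ ≤ roundChange ε L (k + 1) b := by
        rw [roundChange]
        refine mul_le_mul_left (ENNReal.ofReal_le_ofReal ?_) _
        have h0 : (0 : ℝ) ≤ 11 * (k + 1 : ℕ) * √L := by positivity
        have h3 : (((d - d').toNat : ℤ) : ℝ) ≤ 22 * (k + 1 : ℕ) * √L := by
          rw [Int.toNat_eq_max]
          push_cast at *
          exact max_le (by linarith) (by linarith)
        have h4 : (((d - d').toNat : ℕ) : ℝ) = (((d - d').toNat : ℤ) : ℝ) :=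
          (Int.cast_natCast _).symm
        rw [h4]
        linarith

theorem posProb_succ_le_add (h : GoodLevel ε L k) (hb : Window ε L (k + 1) b)
    (hpar : b + 1 ≡ rem (k + 1) [ZMOD 2]) {d : ℤ} (hd : d ∉ deviant ε L ((k + 1) ^ 2)) :
    posProb ε (k + 1) b ≤ posProb ε k (b + d) + roundChange ε L (k + 1) b + tailBound L := by
  rw [posProb_succ]
  exact eexp_coinSum_le_add (by linarith [h.one_le]) (fun _ => posProb_le_one _ _)
    fun d' _ hd' => posProb_le_add h hb hpar hd' hd

theorem posProb_le_succ_add (h : GoodLevel ε L k) (hb : Window ε L (k + 1) b)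
    (hpar : b + 1 ≡ rem (k + 1) [ZMOD 2]) {d : ℤ} (hd : d ∉ deviant ε L ((k + 1) ^ 2)) :
    posProb ε k (b + d) ≤ posProb ε (k + 1) b + roundChange ε L (k + 1) b + tailBound L := by
  rw [posProb_succ]
  exact le_eexp_coinSum_add (by linarith [h.one_le]) (posProb_le_one _ _)
    fun d' _ hd' => posProb_le_add h hb hpar hd hd'

end Level

/-! ### The gain in one round, and its expectation at the stopping round. -/

section Rounds

variable {H : Type*} {m : ℕ} (ε : Set.Icc (-1 : ℝ) 1) (f : ℕ → ℤ → ℤ → PMF H) {L : ℝ}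

theorem withHint_eq_preimage (j : Fin m) (b : ℤ) (h : H) :
    withHint j b h = (fun ω : Fin m → ℤ × H => (partialSum ω j, (ω j).2)) ⁻¹' {(b, h)} := by
  ext ω
  simp [withHint]

theorem eexp_mul_condProb_withHint (j : Fin m) (w : ℤ → ℝ≥0∞) (E : Set (Fin m → ℤ × H)) :
    eexp (game m ε f) (fun ω => w (partialSum ω j) *
      ENNReal.ofReal (condProb (game m ε f) E (withHint j (partialSum ω j) (ω j).2))) =
      eexp (game m ε f) (fun ω => w (partialSum ω j) * E.indicator 1 ω) := by
  simp only [withHint_eq_preimage]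
  exact eexp_mul_condProb (game m ε f) (fun ω => (partialSum ω j, (ω j).2)) (fun x => w x.1) E

theorem dependsOn_comp_partialSum (k : ℕ) (w : ℤ → ℝ≥0∞) :
    DependsOn (fun ω : Fin m → ℤ × H => w (partialSum ω k)) {i | (i : ℕ) < k} :=
  fun _ _ h => congrArg w (partialSum_congr h)

/-- The probability that the final sum is in `T`, from the state of level `ℓ` and offset `b`. -/
noncomputable def finalProb (T : Set ℤ) (ℓ : ℕ) (b : ℤ) : ℝ≥0∞ :=
  pr (coinSum ε (rem ℓ)) {x | b + x ∈ T}

/-- The contribution of the states in which the final sum is unlikely to be in `T`. -/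
noncomputable def unlikelyTerm (L : ℝ) (T : Set ℤ) (ω : Fin m → ℤ × H) (j : Fin m) : ℝ≥0∞ :=
  {b | finalProb ε T (level j) b ≤ tailBound L}.indicator 1 (partialSum ω j) *
    (finalProb ε T (level j) (partialSum ω j) + ENNReal.ofReal (condProb (game m ε f)
      {ω | partialSum ω m ∈ T} (withHint j (partialSum ω j) (ω j).2)))

/-- A particular hint may make `T` likely, but the average over hints is again `finalProb`, by the
tower property. -/
theorem eexp_unlikelyTerm_le (T : Set ℤ) (j : Fin m) :
    eexp (game m ε f) (fun ω => unlikelyTerm ε f L T ω j) ≤ 2 * tailBound L := by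
  set s : Set ℤ := {b | finalProb ε T (level j) b ≤ tailBound L}
  have h1 : eexp (game m ε f) (fun ω => s.indicator 1 (partialSum ω j) *
      finalProb ε T (level j) (partialSum ω j)) ≤ tailBound L := by
    refine le_trans (eexp_mono (h := fun _ => tailBound L) fun ω _ => ?_) (eexp_const _ _).le
    by_cases hs : partialSum ω j ∈ s
    · rw [Set.indicator_of_mem hs, Pi.one_apply, one_mul]; exact hs
    · rw [Set.indicator_of_notMem hs, zero_mul]; exact zero_le
  have h2 : eexp (game m ε f) (fun ω => s.indicator 1 (partialSum ω j) *
      ({ω | partialSum ω m ∈ T} : Set (Fin m → ℤ × H)).indicator 1 ω) =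
      eexp (game m ε f) (fun ω => s.indicator 1 (partialSum ω j) *
      finalProb ε T (level j) (partialSum ω j)) :=
    eexp_game_mul ε f j.2.le (dependsOn_comp_partialSum j (s.indicator 1)) (T.indicator 1)
  simp only [unlikelyTerm, mul_add]
  rw [eexp_add, eexp_mul_condProb_withHint, h2, two_mul]
  exact add_le_add h1 h1

theorem noHint_ne_zero {ω : Fin m → ℤ × H} (hω : game m ε f ω ≠ 0) (j : Fin m) :
    pr (game m ε f) (noHint j (partialSum ω j)) ≠ 0 :=
  pr_pos_of_mem hω (show ω ∈ noHint j (partialSum ω j) from rfl)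

theorem withHint_ne_zero {ω : Fin m → ℤ × H} (hω : game m ε f ω ≠ 0) (j : Fin m) :
    pr (game m ε f) (withHint j (partialSum ω j) (ω j).2) ≠ 0 :=
  pr_pos_of_mem hω (show ω ∈ withHint j (partialSum ω j) (ω j).2 from ⟨rfl, rfl⟩)

theorem condProb_add_compl {α : Type*} (p : PMF α) (E : Set α) {F : Set α} (hF : pr p F ≠ 0) :
    condProb p E F + condProb p Eᶜ F = 1 := by
  have h : ENNReal.ofReal (condProb p E F + condProb p Eᶜ F) * pr p F = 1 * pr p F := by
    rw [ENNReal.ofReal_add (condProb_nonneg _ _ _) (condProb_nonneg _ _ _), add_mul,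
      ofReal_condProb_mul, ofReal_condProb_mul, one_mul, pr, pr, pr, ← eexp_add]
    refine eexp_congr fun x _ => ?_
    by_cases h1 : x ∈ E <;> by_cases h2 : x ∈ F <;> simp [h1, h2]
  exact ENNReal.ofReal_eq_one.1 ((ENNReal.mul_left_inj hF (pr_ne_top _ _)).1 h)

/-- Passing to complements only changes the sign of `c - v`, so whichever of the two final events is
improbable can be used. -/
theorem abs_sub_le_of_not_window (hL : 0 ≤ L) {ω : Fin m → ℤ × H} (hω : game m ε f ω ≠ 0)
    (j : Fin m) (hW : ¬ Window ε L (level j) (partialSum ω j)) :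
    ENNReal.ofReal |cVal m ε f j (partialSum ω j) - vVal m ε f j (partialSum ω j) (ω j).2| ≤
      unlikelyTerm ε f L (Set.Ici 0) ω j + unlikelyTerm ε f L (Set.Ici 0)ᶜ ω j := by
  set b := partialSum ω j with hb
  have hn := noHint_ne_zero ε f hω j
  have hw := withHint_ne_zero ε f hω j
  have key (T : Set ℤ) (hT : finalProb ε T (level j) b ≤ tailBound L) (c v : ℝ)
      (hc : c = condProb (game m ε f) {ω | partialSum ω m ∈ T} (noHint j b))
      (hv : v = condProb (game m ε f) {ω | partialSum ω m ∈ T} (withHint j b (ω j).2)) :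
      ENNReal.ofReal |c - v| ≤ unlikelyTerm ε f L T ω j := by
    have hc0 : 0 ≤ c := hc ▸ condProb_nonneg _ _ _
    have hv0 : 0 ≤ v := hv ▸ condProb_nonneg _ _ _
    have hmem : partialSum ω j ∈ {b | finalProb ε T (level j) b ≤ tailBound L} := hT
    rw [unlikelyTerm, Set.indicator_of_mem hmem, Pi.one_apply, one_mul, ← hb, ← hv]
    have hc' : finalProb ε T (level j) b = ENNReal.ofReal c := by
      rw [hc, condProb_noHint ε f hn, ENNReal.ofReal_toReal (pr_ne_top _ _)]
      rfl
    rw [hc', ← ENNReal.ofReal_add hc0 hv0]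
    exact ENNReal.ofReal_le_ofReal (abs_sub_le_iff.2 ⟨by linarith, by linarith⟩)
  rcases pr_final_small_of_not_window ε L hL hW with h | h
  · exact (key (Set.Ici 0) h _ _ rfl rfl).trans le_self_add
  · refine le_trans (le_of_eq ?_) ((key (Set.Ici 0)ᶜ h _ _ rfl rfl).trans le_add_self)
    have e : ({ω | partialSum ω m ∈ (Set.Ici (0 : ℤ))ᶜ} : Set (Fin m → ℤ × H)) = (finalPos m)ᶜ :=
      rfl
    have h1 := condProb_add_compl (game m ε f) (finalPos m) hn
    have h2 := condProb_add_compl (game m ε f) (finalPos m) hw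
    rw [e, ← abs_neg, cVal, vVal]
    congr 2
    linarith

variable (B : Player H)

theorem eexp_deviant_le (hL : 0 ≤ L) (j : Fin m) :
    eexp (game m ε f) (fun ω => (deviant ε L (level j ^ 2)).indicator 1 (ω j).1) ≤
      tailBound L := by
  have h := eexp_game_mul_coin ε f j (φ := fun _ => 1) (fun _ _ _ => rfl)
    ((deviant ε L (level j ^ 2)).indicator 1)
  rw [eexp_const, one_mul] at h
  simp only [one_mul] at h
  rw [h]
  exact pr_deviant_le ε L hL _

/-- Over all rounds the stopping probabilities of a run add up to at most 1, so the event on `S_m`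
is paid for once. -/
theorem sum_eexp_stopProb_mul_le (T : Set ℤ) :
    ∑ j, eexp (game m ε f) (fun ω => stopProb B ω j * T.indicator 1 (partialSum ω m)) ≤
      pr (coinSum ε (rem m)) T := by
  rw [← eexp_sum]
  have h := eexp_game_mul ε f (Nat.zero_le m) (φ := fun _ => 1) (fun _ _ _ => rfl) (T.indicator 1)
  have h0 (ω : Fin m → ℤ × H) : partialSum ω 0 = 0 := by simp [partialSum]
  simp only [one_mul, h0, zero_add, Nat.sub_zero, eexp_const] at h
  refine le_trans (eexp_mono fun ω _ => ?_) h.le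
  rw [← Finset.sum_mul]
  exact mul_le_of_le_one_left' (sum_stopProb_le_one B ω)

/-- A central offset followed by a typical sum of the remaining coins ends within `w` of 0, the
bound 8 being 4 for each. -/
theorem eexp_stopProb_mul_window_le (hL : 0 ≤ L) {w : ℝ} (j : Fin m)
    (hw : 8 * √(L * rem (level j)) ≤ w) :
    eexp (game m ε f) (fun ω => stopProb B ω j *
        {b | Window ε L (level j) b}.indicator 1 (partialSum ω j)) ≤
      eexp (game m ε f) (fun ω => stopProb B ω j *
        {x : ℤ | |(x : ℝ)| ≤ w}.indicator 1 (partialSum ω m)) + tailBound L := by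
  set W : Set ℤ := {b | Window ε L (level j) b}
  have h := eexp_game_mul ε f j.2.le (dependsOn_comp_partialSum j (W.indicator 1))
    ({x : ℤ | w < |(x : ℝ)|}.indicator 1)
  have h1 : eexp (game m ε f) (fun ω => W.indicator 1 (partialSum ω j) *
      {x : ℤ | w < |(x : ℝ)|}.indicator 1 (partialSum ω m)) ≤ tailBound L := by
    rw [h]
    refine le_trans (eexp_mono (h := fun _ => tailBound L) fun ω _ => ?_) (eexp_const _ _).le
    by_cases hs : partialSum ω j ∈ W
    · rw [Set.indicator_of_mem hs, Pi.one_apply, one_mul]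
      exact pr_final_far_of_window ε L hL hs hw
    · rw [Set.indicator_of_notMem hs, zero_mul]; exact zero_le
  refine le_trans ?_ (add_le_add le_rfl h1)
  rw [← eexp_add]
  refine eexp_mono fun ω _ => ?_
  by_cases hs : partialSum ω j ∈ W
  · rw [Set.indicator_of_mem hs]
    by_cases ht : |(partialSum ω m : ℝ)| ≤ w
    · rw [Set.indicator_of_mem (show partialSum ω m ∈ {x : ℤ | |(x : ℝ)| ≤ w} from ht)]
      exact le_self_add
    · refine le_trans ?_ le_add_self
      rw [Set.indicator_of_mem (show partialSum ω m ∈ {x : ℤ | w < |(x : ℝ)|} from not_le.1 ht)]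
      exact mul_le_mul_left (stopProb_le_one B ω j) _
  · rw [Set.indicator_of_notMem hs, mul_zero]; exact zero_le

theorem level_pos (j : Fin m) : level j - 1 + 1 = level j :=
  Nat.sub_add_cancel (Nat.sub_pos_of_lt j.2)

/-- The decision to stop uses the hint, so only coins after the round are independent of it.
`hitProb_succ_le` first moves the hitting probability past the round. -/
theorem eexp_stopProb_mul_hitProb_le (hm : Odd (rem m)) (j : Fin m)
    (hG : GoodLevel ε L (level j - 1)) :
    eexp (game m ε f) (fun ω => stopProb B ω j *
        ({b | Window ε L (level j) b}.indicator 1 (partialSum ω j) *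
          hitProb ε (level j) (partialSum ω j))) ≤
      3 * eexp (game m ε f) (fun ω => stopProb B ω j *
        ({-1} : Set ℤ).indicator 1 (partialSum ω m)) + 2 * tailBound L := by
  have hL : 0 ≤ L := by linarith [hG.one_le]
  set W : Set ℤ := {b | Window ε L (level j) b}
  have h := eexp_game_mul ε f (show (j : ℕ) + 1 ≤ m from j.2) (dependsOn_stopProb B j)
    (({-1} : Set ℤ).indicator 1)
  have he : m - ((j : ℕ) + 1) = level j - 1 := Nat.sub_succ' m j
  simp only [← hitProb_eq_eexp, he] at h
  rw [h]
  have h1 : eexp (game m ε f) (fun ω => stopProb B ω j *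
        (W.indicator 1 (partialSum ω j) * hitProb ε (level j) (partialSum ω j))) ≤
      eexp (game m ε f) (fun ω => 3 * (stopProb B ω j *
        hitProb ε (level j - 1) (partialSum ω (j + 1))) + tailBound L +
          (deviant ε L (level j ^ 2)).indicator 1 (ω j).1) := by
    refine eexp_mono fun ω hω => ?_
    by_cases hs : partialSum ω j ∈ W
    · rw [Set.indicator_of_mem hs, Pi.one_apply, one_mul]
      by_cases hd : (ω j).1 ∈ deviant ε L (level j ^ 2)
      · rw [Set.indicator_of_mem hd]
        exact le_trans (mul_le_one' (stopProb_le_one B ω j) (hitProb_le_one _ _)) le_add_self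
      · refine le_trans ?_ le_self_add
        have hp := partialSum_parity ε f hω j hm
        have hc := coinSum_ne_zero_of_game ε f hω j
        have hW : Window ε L (level j) (partialSum ω j) := hs
        rw [partialSum_succ]
        rw [← level_pos j] at hd hc hp hW
        have h2 := hitProb_succ_le hG hW hp hc hd
        rw [level_pos j] at h2
        calc stopProb B ω j * hitProb ε (level j) (partialSum ω j)
            ≤ stopProb B ω j * (3 * hitProb ε (level j - 1) (partialSum ω j + (ω j).1) +
              tailBound L) := by gcongr
          _ = 3 * (stopProb B ω j * hitProb ε (level j - 1) (partialSum ω j + (ω j).1)) +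
              stopProb B ω j * tailBound L := by ring
          _ ≤ _ := by
              gcongr
              exact mul_le_of_le_one_left' (stopProb_le_one B ω j)
    · rw [Set.indicator_of_notMem hs, zero_mul, mul_zero]; exact zero_le
  refine h1.trans ?_
  rw [eexp_add, eexp_add, eexp_const, eexp_const_mul, two_mul, ← add_assoc]
  exact add_le_add le_rfl (eexp_deviant_le ε f hL j)

/-- The conditional probability that the coins of the round are deviant, given the hint. -/
noncomputable def deviantTerm (L : ℝ) (ω : Fin m → ℤ × H) (j : Fin m) : ℝ≥0∞ :=
  ENNReal.ofReal (condProb (game m ε f) {ω | (ω j).1 ∈ deviant ε L (level j ^ 2)}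
    (withHint j (partialSum ω j) (ω j).2))

theorem eexp_deviantTerm_le (hL : 0 ≤ L) (j : Fin m) :
    eexp (game m ε f) (fun ω => deviantTerm ε f L ω j) ≤ tailBound L := by
  have h := eexp_mul_condProb_withHint ε f j (fun _ => 1)
    {ω | (ω j).1 ∈ deviant ε L (level j ^ 2)}
  simp only [one_mul] at h
  exact h.le.trans (eexp_deviant_le ε f hL j)

/-- For any hint, `v` averages `posProb` over some law of the round's coins. Typical coins keep
`posProb` within `roundChange + tailBound` of `c`, and deviant ones cost at most 1. -/
theorem abs_sub_le_of_window (hm : Odd (rem m)) {ω : Fin m → ℤ × H} (hω : game m ε f ω ≠ 0)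
    (j : Fin m) (hG : GoodLevel ε L (level j - 1))
    (hW : Window ε L (level j) (partialSum ω j)) :
    ENNReal.ofReal |cVal m ε f j (partialSum ω j) - vVal m ε f j (partialSum ω j) (ω j).2| ≤
      roundChange ε L (level j) (partialSum ω j) + tailBound L + deviantTerm ε f L ω j := by
  have hp := partialSum_parity ε f hω j hm
  have hn := noHint_ne_zero ε f hω j
  have hw := withHint_ne_zero ε f hω j
  rw [deviantTerm]
  set b := partialSum ω j
  set a := (ω j).2
  rw [← level_pos j] at hW hp
  set k := level j - 1 with hk
  have hlev : level j = k + 1 := (level_pos j).symm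
  set D := deviant ε L ((k + 1) ^ 2) with hD
  set c := posProb ε (k + 1) b with hc
  set R := roundChange ε L (k + 1) b + tailBound L with hR
  have hv0 : 0 ≤ vVal m ε f j b a := condProb_nonneg _ _ _
  set v := ENNReal.ofReal (vVal m ε f j b a) with hv
  set F := withHint (m := m) j b a
  have hvm : v * pr (game m ε f) F =
      eexp (game m ε f) (fun ω => F.indicator 1 ω * posProb ε k (b + (ω j).1)) :=
    ofReal_vVal_mul ε f j b a
  have hβ := ofReal_condProb_mul (game m ε f) {ω | (ω j).1 ∈ D} F
  rw [hlev]
  set β := ENNReal.ofReal (condProb (game m ε f) {ω | (ω j).1 ∈ D} F)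
  have hβ' : β * pr (game m ε f) F =
      eexp (game m ε f) (fun ω => F.indicator 1 ω * D.indicator 1 (ω j).1) := by
    rw [hβ]
    refine eexp_congr fun ω' _ => ?_
    by_cases g1 : ω' ∈ F <;> by_cases g2 : (ω' j).1 ∈ D <;> simp [g1, g2]
  have hconst (x : ℝ≥0∞) : x * pr (game m ε f) F =
      eexp (game m ε f) (fun ω => F.indicator 1 ω * x) := by
    rw [eexp_mul_const, mul_comm]; rfl
  have hle (d : ℤ) : c ≤ posProb ε k (b + d) + R + D.indicator 1 d ∧
      posProb ε k (b + d) ≤ c + R + D.indicator 1 d := by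
    by_cases hd : d ∈ D
    · rw [Set.indicator_of_mem hd]
      exact ⟨(posProb_le_one _ _).trans le_add_self, (posProb_le_one _ _).trans le_add_self⟩
    · rw [hR, ← add_assoc, ← add_assoc]
      exact ⟨(posProb_succ_le_add hG hW hp hd).trans le_self_add,
        (posProb_le_succ_add hG hW hp hd).trans le_self_add⟩
  -- After multiplication by the mass of the state, the claim is a pointwise comparison under one
  -- expectation.
  have h1 : c ≤ v + R + β := by
    refine (ENNReal.mul_le_mul_iff_left hw (pr_ne_top _ _)).1 ?_
    rw [add_mul, add_mul, hvm, hβ', hconst, hconst, ← eexp_add, ← eexp_add]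
    refine eexp_mono fun ω' _ => ?_
    rw [← mul_add, ← mul_add]
    exact mul_le_mul_right (hle _).1 _
  have h2 : v ≤ c + R + β := by
    refine (ENNReal.mul_le_mul_iff_left hw (pr_ne_top _ _)).1 ?_
    rw [add_mul, add_mul, hvm, hβ', hconst, hconst, ← eexp_add, ← eexp_add]
    refine eexp_mono fun ω' _ => ?_
    rw [← mul_add, ← mul_add]
    exact mul_le_mul_right (hle _).2 _
  have hcv : ENNReal.ofReal (cVal m ε f j b) = c := by
    rw [cVal_eq ε f hn, hlev]; exact ENNReal.ofReal_toReal (pr_ne_top _ _)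
  have hc0 : 0 ≤ cVal m ε f j b := condProb_nonneg _ _ _
  rcases le_total (vVal m ε f j b a) (cVal m ε f j b) with h | h
  · rw [abs_of_nonneg (by linarith), ENNReal.ofReal_sub _ hv0, hcv, tsub_le_iff_left, ← add_assoc]
    exact h1
  · rw [abs_of_nonpos (by linarith), neg_sub, ENNReal.ofReal_sub _ hc0, hcv, tsub_le_iff_left,
      ← add_assoc]
    exact h2

/-- The bound on the conditional mass of bad hints is averaged over the offset. -/
theorem eexp_badHint_le {j : Fin m} {A : ℤ → Set H} {Q : Set ℤ} {r : ℝ}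
    (hA : ∀ b ∈ Q, ∑' h : ((A b)ᶜ : Set H),
      condProb (game m ε f) (withHint j b (h : H)) (noHint j b) ≤ r) :
    pr (game m ε f) {ω | partialSum ω j ∈ Q ∧ (ω j).2 ∉ A (partialSum ω j)} ≤
      ENNReal.ofReal r := by
  set E : Set (Fin m → ℤ × H) := {ω | partialSum ω j ∈ Q ∧ (ω j).2 ∉ A (partialSum ω j)} with hE
  have hfib : ∀ b, eexp (game m ε f) (fun ω => ((fun ω : Fin m → ℤ × H => partialSum ω j) ⁻¹'
      {b}).indicator 1 ω * E.indicator 1 ω) ≤ ENNReal.ofReal r * eexp (game m ε f)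
      (fun ω => ((fun ω : Fin m → ℤ × H => partialSum ω j) ⁻¹' {b}).indicator 1 ω * 1) := by
    intro b
    simp only [mul_one]
    set F : Set (Fin m → ℤ × H) := (fun ω : Fin m → ℤ × H => partialSum ω j) ⁻¹' {b} with hF
    have hFn : F = noHint j b := rfl
    change _ ≤ ENNReal.ofReal r * pr (game m ε f) F
    by_cases h0 : pr (game m ε f) F = 0
    · rw [h0, mul_zero, ← h0]
      exact eexp_mono fun ω _ => mul_le_of_le_one_right' (indicator_one_le_one E ω)
    by_cases hQ : b ∈ Q
    · have hsum : (∑' h : ((A b)ᶜ : Set H),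
          ENNReal.ofReal (condProb (game m ε f) (withHint j b (h : H)) (noHint j b))) *
            pr (game m ε f) F = eexp (game m ε f) (fun ω => F.indicator 1 ω * E.indicator 1 ω) := by
        rw [hFn, ← ENNReal.tsum_mul_right]
        simp only [ofReal_condProb_mul]
        rw [tsum_subtype ((A b)ᶜ) (fun h => pr (game m ε f) (withHint j b h ∩ noHint j b)),
          eexp_eq_tsum_fiber (game m ε f) (fun ω => (ω j).2)]
        refine tsum_congr fun h => ?_
        by_cases hh : h ∈ (A b)ᶜ
        · rw [Set.indicator_of_mem hh]
          refine eexp_congr fun ω _ => ?_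
          have hiff : ω ∈ withHint j b h ∩ noHint j b ↔ (ω j).2 = h ∧ ω ∈ noHint j b ∧ ω ∈ E := by
            constructor
            · rintro ⟨⟨g1, g2⟩, g3⟩
              exact ⟨g2, g3, by rw [hE]; exact ⟨g1 ▸ hQ, by rw [g1, g2]; exact hh⟩⟩
            · rintro ⟨g1, g2, g3⟩
              exact ⟨⟨g2, g1⟩, g2⟩
          by_cases g : ω ∈ withHint j b h ∩ noHint j b
          · obtain ⟨k1, k2, k3⟩ := hiff.1 g
            rw [Set.indicator_of_mem g, Set.indicator_of_mem (show ω ∈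
              (fun ω : Fin m → ℤ × H => (ω j).2) ⁻¹' {h} from k1), Set.indicator_of_mem k2,
              Set.indicator_of_mem k3]
            simp
          · rw [Set.indicator_of_notMem g]
            by_contra hne
            obtain ⟨k1, k23⟩ := mul_ne_zero_iff.1 (Ne.symm hne)
            obtain ⟨k2, k3⟩ := mul_ne_zero_iff.1 k23
            have k1' := Set.mem_of_indicator_ne_zero k1
            exact g (hiff.2 ⟨k1', Set.mem_of_indicator_ne_zero k2,
              Set.mem_of_indicator_ne_zero k3⟩)
        · rw [Set.indicator_of_notMem hh]
          symm
          refine (eexp_congr (h := fun _ => 0) fun ω _ => ?_).trans (eexp_const _ _)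
          by_cases k1 : (ω j).2 = h
          · by_cases k2 : ω ∈ noHint j b
            · have k3 : ω ∉ E := by
                rintro ⟨_, g⟩
                have k2' : partialSum ω j = b := k2
                rw [k2', k1] at g
                exact hh g
              rw [Set.indicator_of_notMem k3, mul_zero, mul_zero]
            · rw [Set.indicator_of_notMem k2, zero_mul, mul_zero]
          · rw [Set.indicator_of_notMem (show ω ∉ (fun ω : Fin m → ℤ × H => (ω j).2) ⁻¹' {h}
              from k1), zero_mul]
      rw [← hsum]
      gcongr
      -- An infinite sum would have real value 0 by default. It is excluded because the sum times
      -- the positive mass of `F` is a probability.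
      have hne : (∑' h : ((A b)ᶜ : Set H), ENNReal.ofReal
          (condProb (game m ε f) (withHint j b (h : H)) (noHint j b))) ≠ ∞ := by
        intro htop
        rw [htop, ENNReal.top_mul h0] at hsum
        have : eexp (game m ε f) (fun ω => F.indicator 1 ω * E.indicator 1 ω) ≤ 1 :=
          eexp_le_one fun ω => mul_le_one' (indicator_one_le_one F ω) (indicator_one_le_one E ω)
        rw [← hsum] at this
        exact absurd this (by simp)
      have h3 := hA b hQ
      have h4 : (∑' h : ((A b)ᶜ : Set H), ENNReal.ofReal
          (condProb (game m ε f) (withHint j b (h : H)) (noHint j b))).toReal ≤ r := by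
        rw [ENNReal.tsum_toReal_eq fun _ => ENNReal.ofReal_ne_top]
        simp only [ENNReal.toReal_ofReal (condProb_nonneg _ _ _)]
        exact h3
      exact (ENNReal.le_ofReal_iff_toReal_le hne (ENNReal.toReal_nonneg.trans h4)).2 h4
    · refine le_trans (le_of_eq ?_) (zero_le)
      refine (eexp_congr (h := fun _ => 0) fun ω _ => ?_).trans (eexp_const _ _)
      by_cases k1 : ω ∈ F
      · have k3 : ω ∉ E := by
          rintro ⟨g, _⟩
          have k1' : partialSum ω j = b := k1
          exact hQ (k1' ▸ g)
        rw [Set.indicator_of_notMem k3, mul_zero]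
      · rw [Set.indicator_of_notMem k1, zero_mul]
  rw [pr, eexp_eq_tsum_fiber (game m ε f) (fun ω => partialSum ω j)]
  refine (ENNReal.tsum_le_tsum hfib).trans ?_
  rw [ENNReal.tsum_mul_left, ← eexp_eq_tsum_fiber, eexp_const, mul_one]

end Rounds

/-! ### Summation over the rounds. -/

section Total

variable {H : Type*} {m : ℕ} (ε : Set.Icc (-1 : ℝ) 1) (f : ℕ → ℤ → ℤ → PMF H) {L : ℝ}
  (B : Player H)

/-- The bound on the gain of a bet in round `j + 1`; levels below `t` are bounded trivially. -/
noncomputable def gainBound (L : ℝ) (t : ℕ) (K : ℝ≥0∞) (E : Fin m → Set (Fin m → ℤ × H))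
    (ω : Fin m → ℤ × H) (j : Fin m) : ℝ≥0∞ :=
  unlikelyTerm ε f L (Set.Ici 0) ω j + unlikelyTerm ε f L (Set.Ici 0)ᶜ ω j +
    if level j < t then {b | Window ε L (level j) b}.indicator 1 (partialSum ω j)
    else K * ({b | Window ε L (level j) b}.indicator 1 (partialSum ω j) *
      hitProb ε (level j) (partialSum ω j)) + (tailBound L + deviantTerm ε f L ω j +
        (E j).indicator 1 ω)

/-- Main terms are charged to `|S_m| ≤ w` or `S_m = -1`. Only tails and bad hints are paid per
round, which gives the factor `m`. -/
theorem sum_eexp_gainBound_le (hL : 1 ≤ L) (hm : Odd (rem m)) {t : ℕ} {w : ℝ} {K ρ : ℝ≥0∞}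
    {E : Fin m → Set (Fin m → ℤ × H)}
    (hG : ∀ j : Fin m, t ≤ level j → GoodLevel ε L (level j - 1))
    (hw : ∀ j : Fin m, level j < t → 8 * √(L * rem (level j)) ≤ w)
    (hE : ∀ j, pr (game m ε f) (E j) ≤ ρ) :
    ∑ j, eexp (game m ε f) (fun ω => stopProb B ω j * gainBound ε f L t K E ω j) ≤
      pr (coinSum ε (rem m)) {x : ℤ | |(x : ℝ)| ≤ w} + K * (3 * coinSum ε (rem m) (-1)) +
        m * (6 * tailBound L + 2 * (K * tailBound L) + ρ) := by
  have hL0 : 0 ≤ L := by linarith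
  set δ := tailBound L with hδ
  set a : Fin m → ℝ≥0∞ := fun j => eexp (game m ε f) (fun ω => stopProb B ω j *
    {x : ℤ | |(x : ℝ)| ≤ w}.indicator 1 (partialSum ω m)) with ha
  set c : Fin m → ℝ≥0∞ := fun j => eexp (game m ε f) (fun ω => stopProb B ω j *
    ({-1} : Set ℤ).indicator 1 (partialSum ω m)) with hc
  have hround (j : Fin m) :
      eexp (game m ε f) (fun ω => stopProb B ω j * gainBound ε f L t K E ω j) ≤
        a j + K * (3 * c j) + (6 * δ + 2 * (K * δ) + ρ) := by
    have hU (T : Set ℤ) : eexp (game m ε f) (fun ω => stopProb B ω j * unlikelyTerm ε f L T ω j) ≤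
        2 * δ :=
      (eexp_mono fun ω _ => mul_le_of_le_one_left' (stopProb_le_one B ω j)).trans
        (eexp_unlikelyTerm_le ε f T j)
    simp only [gainBound, mul_add]
    rw [eexp_add, eexp_add]
    have h0 := add_le_add (hU (Set.Ici 0)) (hU (Set.Ici 0)ᶜ)
    by_cases hj : level j < t
    · simp only [if_pos hj]
      have h1 := eexp_stopProb_mul_window_le ε f B hL0 j (hw j hj)
      refine (add_le_add h0 h1).trans ?_
      -- Low rounds need only `5δ`; the surplus makes the bound uniform in `j`.
      calc 2 * δ + 2 * δ + (a j + δ) = a j + 5 * δ := by ring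
        _ ≤ a j + 5 * δ + (K * (3 * c j) + (δ + 2 * (K * δ) + ρ)) := le_self_add
        _ = _ := by ring
    · simp only [if_neg hj, mul_add, mul_left_comm _ K]
      rw [eexp_add, eexp_const_mul, eexp_add, eexp_add]
      have h1 := eexp_stopProb_mul_hitProb_le ε f B hm j (hG j (not_lt.1 hj))
      have h2 : eexp (game m ε f) (fun ω => stopProb B ω j * δ) ≤ δ :=
        (eexp_mono fun ω _ => mul_le_of_le_one_left' (stopProb_le_one B ω j)).trans
          (eexp_const _ _).le
      have h3 : eexp (game m ε f) (fun ω => stopProb B ω j * deviantTerm ε f L ω j) ≤ δ :=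
        (eexp_mono fun ω _ => mul_le_of_le_one_left' (stopProb_le_one B ω j)).trans
          (eexp_deviantTerm_le ε f hL0 j)
      have h4 : eexp (game m ε f) (fun ω => stopProb B ω j * (E j).indicator 1 ω) ≤ ρ :=
        (eexp_mono fun ω _ => mul_le_of_le_one_left' (stopProb_le_one B ω j)).trans (hE j)
      refine (add_le_add h0 (add_le_add (mul_le_mul_right h1 K)
        (add_le_add (add_le_add h2 h3) h4))).trans ?_
      calc 2 * δ + 2 * δ + (K * (3 * c j + 2 * δ) + (δ + δ + ρ))
          = K * (3 * c j) + (6 * δ + 2 * (K * δ) + ρ) := by ring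
        _ ≤ a j + (K * (3 * c j) + (6 * δ + 2 * (K * δ) + ρ)) := le_add_self
        _ = _ := by ring
  refine (Finset.sum_le_sum fun j _ => hround j).trans ?_
  rw [Finset.sum_add_distrib, Finset.sum_add_distrib, ← Finset.mul_sum, ← Finset.mul_sum,
    Finset.sum_const, Finset.card_univ, Fintype.card_fin, nsmul_eq_mul]
  have hs1 : ∑ j, a j ≤ _ := sum_eexp_stopProb_mul_le ε f B {x : ℤ | |(x : ℝ)| ≤ w}
  have hs2 : ∑ j, c j ≤ coinSum ε (rem m) (-1) :=
    (sum_eexp_stopProb_mul_le ε f B {-1}).trans_eq (pr_singleton _ _)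
  gcongr

theorem pr_abs_le (hm : Odd (rem m)) {w : ℝ} (hw : 0 ≤ w) (hε : |(ε : ℝ)| * w ≤ 1) :
    pr (coinSum ε (rem m)) {x : ℤ | |(x : ℝ)| ≤ w} ≤
      ENNReal.ofReal ((2 * w + 1) * (3 / √(rem m))) := by
  set s : Finset ℤ := Finset.Icc (-(⌊w⌋₊ : ℤ)) ⌊w⌋₊ with hs
  have hfl : (⌊w⌋₊ : ℝ) ≤ w := Nat.floor_le hw
  have h1 : pr (coinSum ε (rem m)) {x : ℤ | |(x : ℝ)| ≤ w} ≤ ∑ a ∈ s, coinSum ε (rem m) a := by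
    simp only [← pr_singleton (coinSum ε (rem m)), pr]
    rw [← eexp_sum]
    refine eexp_mono fun x _ => ?_
    by_cases hx : |(x : ℝ)| ≤ w
    · have hxs : x ∈ s := by
        have hx1 : x.natAbs ≤ ⌊w⌋₊ := Nat.le_floor (by rw [Nat.cast_natAbs]; exact_mod_cast hx)
        rw [hs, Finset.mem_Icc]
        omega
      refine le_trans ?_ (Finset.single_le_sum (f := fun a : ℤ =>
        ({a} : Set ℤ).indicator (1 : ℤ → ℝ≥0∞) x) (fun _ _ => zero_le) hxs)
      rw [Set.indicator_of_mem (by exact hx), Set.indicator_of_mem (Set.mem_singleton x)]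
    · rw [Set.indicator_of_notMem (by exact hx)]
      exact zero_le
  refine h1.trans ((Finset.sum_le_card_nsmul _ _ (ENNReal.ofReal (3 / √(rem m))) ?_).trans ?_)
  · intro a ha
    rw [hs, Finset.mem_Icc] at ha
    rw [← ENNReal.ofReal_toReal (PMF.apply_ne_top (coinSum ε (rem m)) a)]
    refine ENNReal.ofReal_le_ofReal (coinSum_toReal_le ε hm a (le_trans ?_ hε))
    have h2 : ((-(⌊w⌋₊ : ℤ) : ℤ) : ℝ) ≤ a := by exact_mod_cast ha.1
    have h3 : (a : ℝ) ≤ ((⌊w⌋₊ : ℤ) : ℝ) := by exact_mod_cast ha.2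
    push_cast at h2 h3
    gcongr
    exact abs_le.2 ⟨by linarith, by linarith⟩
  · rw [nsmul_eq_mul, ENNReal.ofReal_mul (by positivity), ← ENNReal.ofReal_natCast]
    gcongr
    rw [hs, Int.card_Icc]
    have : (((⌊w⌋₊ : ℤ) + 1 - -(⌊w⌋₊ : ℤ)).toNat : ℝ) = 2 * ⌊w⌋₊ + 1 := by
      have h4 : ((⌊w⌋₊ : ℤ) + 1 - -(⌊w⌋₊ : ℤ)).toNat = 2 * ⌊w⌋₊ + 1 := by omega
      rw [h4]; push_cast; ring
    rw [this]
    linarith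

theorem abs_bias_le {ℓ : ℕ} (hℓ : 0 < ℓ) (hℓm : ℓ ≤ m) (hL : 0 ≤ L)
    (hε : |(ε : ℝ)| < 4 * √(L / rem m)) : |(ε : ℝ)| ≤ 7 * √L / √(ℓ : ℝ) ^ 3 := by
  set z := √(ℓ : ℝ) with hz
  have hℓ' : (0 : ℝ) < ℓ := by exact_mod_cast hℓ
  have hz0 : 0 < z := Real.sqrt_pos.2 hℓ'
  have hz2 : z ^ 2 = ℓ := Real.sq_sqrt hℓ'.le
  have h1 : ((ℓ : ℝ)) ^ 3 ≤ 3 * rem m := by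
    exact_mod_cast (Nat.pow_le_pow_left hℓm 3).trans (le_three_mul_rem m)
  have h2 : L / rem m ≤ (7 / 4 * √L / z ^ 3) ^ 2 := by
    have h3 : (7 / 4 * √L / z ^ 3) ^ 2 = 49 / 16 * L / ℓ ^ 3 := by
      rw [div_pow, mul_pow, Real.sq_sqrt hL, ← hz2]; ring
    have h0 : (0 : ℝ) < rem m := by
      have : 0 < (ℓ : ℝ) ^ 3 := by positivity
      linarith
    rw [h3, div_le_div_iff₀ h0 (by positivity)]
    nlinarith
  have h4 : √(L / rem m) ≤ 7 / 4 * √L / z ^ 3 :=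
    Real.sqrt_le_iff.2 ⟨by positivity, h2⟩
  calc |(ε : ℝ)| ≤ 4 * (7 / 4 * √L / z ^ 3) := by linarith
    _ = 7 * √L / z ^ 3 := by ring

/-- With masses `O(m^(-3/2))` the two main terms are `O(1/m)` and `O(K τ √L / m)`. The constants are
`31 = 18 + 12 + 1` and `22 = 18 + 4`. -/
theorem total_le (hL : 1 ≤ L) (hLm : L ≤ m) (hm49 : 49 ≤ m)
    (hexp : Real.exp (-8 * L) ≤ 1 / (m : ℝ) ^ 3) (hm : Odd (rem m))
    (hε : |(ε : ℝ)| < 4 * √(L / rem m)) {τ K : ℝ} (hτ : 1 ≤ τ) (hK : 0 ≤ K) :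
    pr (coinSum ε (rem m)) {x : ℤ | |(x : ℝ)| ≤ √m} +
        ENNReal.ofReal (K * τ * √(m * L)) * (3 * coinSum ε (rem m) (-1)) +
        m * (6 * tailBound L + 2 * (ENNReal.ofReal (K * τ * √(m * L)) * tailBound L) +
          ENNReal.ofReal (1 / (m : ℝ) ^ 2)) ≤
      ENNReal.ofReal ((31 + 22 * K) * (τ * √L / m)) := by
  set s := √(m : ℝ) with hs
  set y := √L with hy
  have hm' : (49 : ℝ) ≤ m := by exact_mod_cast hm49
  have hs2 : (m : ℝ) = s ^ 2 := (Real.sq_sqrt (by linarith)).symm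
  have hs7 : 7 ≤ s := Real.le_sqrt_of_sq_le (by linarith)
  have hy1 : 1 ≤ y := Real.one_le_sqrt.2 hL
  have hys : y ≤ s := Real.sqrt_le_sqrt hLm
  have hsq : √(m * L) = s * y := Real.sqrt_mul (by linarith) L
  have hεs : |(ε : ℝ)| * s ≤ 1 := by
    have h1 := abs_bias_le ε (L := L) (show 0 < m by omega) le_rfl (by linarith) hε
    calc |(ε : ℝ)| * s ≤ 7 * y / s ^ 3 * s := by gcongr
      _ = 7 * y / s ^ 2 := by field_simp
      _ ≤ 1 := by rw [div_le_one (by positivity)]; nlinarith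
  have hεs1 : |(ε : ℝ)| * |((-1 : ℤ) : ℝ)| ≤ 1 := by
    have := abs_nonneg (ε : ℝ)
    simp
    nlinarith
  have hrem : 3 / √(rem m) ≤ 6 / s ^ 3 := by
    have h1 : (m : ℝ) ^ 3 ≤ 3 * rem m := by exact_mod_cast le_three_mul_rem m
    have h2 : s ^ 3 / 2 ≤ √(rem m) := by
      refine Real.le_sqrt_of_sq_le ?_
      have : (s ^ 3 / 2) ^ 2 = (m : ℝ) ^ 3 / 4 := by rw [hs2]; ring
      have h3 : 0 ≤ (m : ℝ) ^ 3 := by positivity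
      linarith
    calc 3 / √(rem m) ≤ 3 / (s ^ 3 / 2) := by gcongr
      _ = 6 / s ^ 3 := by field_simp; norm_num
  have hδ : tailBound L ≤ ENNReal.ofReal (2 / (m : ℝ) ^ 3) :=
    ENNReal.ofReal_le_ofReal (by
      have : 2 / (m : ℝ) ^ 3 = 2 * (1 / (m : ℝ) ^ 3) := by ring
      rw [this]; gcongr)
  have hpr : pr (coinSum ε (rem m)) {x : ℤ | |(x : ℝ)| ≤ s} ≤
      ENNReal.ofReal ((2 * s + 1) * (6 / s ^ 3)) :=
    (pr_abs_le ε hm (by linarith) hεs).trans (ENNReal.ofReal_le_ofReal (by gcongr))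
  have hhit : coinSum ε (rem m) (-1) ≤ ENNReal.ofReal (6 / s ^ 3) := by
    rw [← ENNReal.ofReal_toReal (PMF.apply_ne_top (coinSum ε (rem m)) (-1))]
    exact ENNReal.ofReal_le_ofReal ((coinSum_toReal_le ε hm (-1) hεs1).trans hrem)
  set k := K * τ * √(m * L) with hk
  have hk0 : 0 ≤ k := by positivity
  have e3 : (3 : ℝ≥0∞) = ENNReal.ofReal 3 := (ENNReal.ofReal_ofNat 3).symm
  have e6 : (6 : ℝ≥0∞) = ENNReal.ofReal 6 := (ENNReal.ofReal_ofNat 6).symm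
  have e2 : (2 : ℝ≥0∞) = ENNReal.ofReal 2 := (ENNReal.ofReal_ofNat 2).symm
  have em : (m : ℝ≥0∞) = ENNReal.ofReal m := (ENNReal.ofReal_natCast m).symm
  have hs0 : 0 < s := by linarith
  calc _ ≤ ENNReal.ofReal ((2 * s + 1) * (6 / s ^ 3)) +
        ENNReal.ofReal k * (3 * ENNReal.ofReal (6 / s ^ 3)) +
        m * (6 * ENNReal.ofReal (2 / (m : ℝ) ^ 3) +
          2 * (ENNReal.ofReal k * ENNReal.ofReal (2 / (m : ℝ) ^ 3)) +
          ENNReal.ofReal (1 / (m : ℝ) ^ 2)) := by gcongr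
    _ = ENNReal.ofReal ((2 * s + 1) * (6 / s ^ 3) + k * (3 * (6 / s ^ 3)) +
        m * (6 * (2 / (m : ℝ) ^ 3) + 2 * (k * (2 / (m : ℝ) ^ 3)) + 1 / (m : ℝ) ^ 2)) := by
        rw [e3, e6, e2, em]
        simp (disch := positivity) only [ENNReal.ofReal_add, ENNReal.ofReal_mul]
    _ ≤ _ := by
        refine ENNReal.ofReal_le_ofReal ?_
        rw [hk, hsq, hs2]
        set q := K * τ * y
        have hq : 0 ≤ q := by positivity
        have hty : 1 ≤ τ * y := by nlinarith
        have i1 : (2 * s + 1) * (6 / s ^ 3) ≤ 18 / s ^ 2 := by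
          have : (2 * s + 1) * (6 / s ^ 3) ≤ (3 * s) * (6 / s ^ 3) := by gcongr; linarith
          refine this.trans_eq ?_
          field_simp
          norm_num
        have i2 : K * τ * (s * y) * (3 * (6 / s ^ 3)) = 18 * q / s ^ 2 := by
          simp only [q]; field_simp; ring
        have i3 : s ^ 2 * (6 * (2 / (s ^ 2) ^ 3) + 2 * (K * τ * (s * y) * (2 / (s ^ 2) ^ 3)) +
            1 / (s ^ 2) ^ 2) = 12 / s ^ 4 + 4 * q / s ^ 3 + 1 / s ^ 2 := by
          simp only [q]; field_simp; ring
        have i4 : 12 / s ^ 4 ≤ 12 / s ^ 2 := by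
          gcongr
          · linarith
          · norm_num
        have i5 : 4 * q / s ^ 3 ≤ 4 * q / s ^ 2 := by
          gcongr
          · linarith
          · norm_num
        have i6 : (31 + 22 * K) * (τ * y / s ^ 2) = 31 * (τ * y) / s ^ 2 + 22 * q / s ^ 2 := by
          simp only [q]; ring
        have i7 : 31 / s ^ 2 ≤ 31 * (τ * y) / s ^ 2 := by gcongr; linarith
        rw [i2, i3, i6]
        have i8 : 18 / s ^ 2 + 12 / s ^ 2 + 1 / s ^ 2 = 31 / s ^ 2 := by ring
        have i9 : 18 * q / s ^ 2 + 4 * q / s ^ 2 = 22 * q / s ^ 2 := by ring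
        linarith

end Total

/-! ### The case distinction for the gain. -/

section Gain

variable {H : Type*} {m : ℕ} (ε : Set.Icc (-1 : ℝ) 1) (f : ℕ → ℤ → ℤ → PMF H)

/-- `gainBound` bounds the gain in every state that is reached with positive probability. -/
theorem ofReal_le_gainBound {L τ c' : ℝ} (hLdef : L = Real.logb 2 m) (hL : 1 ≤ L) (hτ : 1 ≤ τ)
    (hτL : τ / √(m : ℝ) * L ^ 3 < 1) (hm0 : 0 < m) (hm : Odd (rem m)) {t : ℕ}
    (ht : t = ⌊(m : ℝ) ^ (1 / 8 : ℝ)⌋₊)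
    (hG : ∀ j : Fin m, t ≤ level j → GoodLevel ε L (level j - 1)) {A : Fin m → ℤ → Set H}
    -- An abstract `γ` serves both `c - v` and its negative.
    {γ : Fin m → ℤ → H → ℝ}
    (hγ : ∀ j b h, γ j b h ≤ |cVal m ε f j b - vVal m ε f j b h|)
    (hA : ∀ j b, Typical m ε τ j b → ∀ h ∈ A j b, γ j b h ≤ changeBound m ε f τ c' j b)
    {ω : Fin m → ℤ × H} (hω : game m ε f ω ≠ 0) (j : Fin m) :
    ENNReal.ofReal (γ j (partialSum ω j) (ω j).2) ≤
      gainBound ε f L t (ENNReal.ofReal ((132 + |c'|) * τ * √(m * L)))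
        (fun j => {ω | partialSum ω j ∈ {b | Typical m ε τ j b} ∧
          (ω j).2 ∉ A j (partialSum ω j)}) ω j := by
  have hle := ENNReal.ofReal_le_ofReal (hγ j (partialSum ω j) (ω j).2)
  have hle1 : ENNReal.ofReal (γ j (partialSum ω j) (ω j).2) ≤ 1 := by
    refine hle.trans (ENNReal.ofReal_le_one.2 ?_)
    exact abs_sub_le_of_nonneg_of_le (condProb_nonneg _ _ _) (condProb_le_one _ _ _)
      (condProb_nonneg _ _ _) (condProb_le_one _ _ _)
  rw [gainBound]
  by_cases hW : Window ε L (level j) (partialSum ω j)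
  swap
  · exact (hle.trans (abs_sub_le_of_not_window ε f (by linarith) hω j hW)).trans le_self_add
  refine le_trans ?_ le_add_self
  rw [Set.indicator_of_mem (show partialSum ω j ∈ {b | Window ε L (level j) b} from hW)]
  by_cases hj : level j < t
  · rw [if_pos hj]; exact hle1
  rw [if_neg hj, Pi.one_apply, one_mul]
  rw [not_lt] at hj
  have hm' : (0 : ℝ) < m := by exact_mod_cast hm0
  by_cases hlev : τ ^ 2 * L ^ 3 ≤ level j
  · have hT : Typical m ε τ j (partialSum ω j) := by
      refine ⟨by rw [← hLdef]; exact hW, max_le ?_ ?_, partialSum_parity ε f hω j hm⟩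
      · rw [← ht]; exact_mod_cast hj
      · rw [← hLdef]; exact hlev
    by_cases hh : (ω j).2 ∈ A j (partialSum ω j)
    · refine le_trans ?_ le_self_add
      refine (ENNReal.ofReal_le_ofReal (hA j _ hT _ hh)).trans ?_
      rw [changeBound, condProb_finalState_eq ε f (noHint_ne_zero ε f hω j), ← hLdef,
        ENNReal.ofReal_mul' ENNReal.toReal_nonneg]
      refine mul_le_mul' (ENNReal.ofReal_le_ofReal ?_) ENNReal.ofReal_toReal_le
      gcongr
      linarith [le_abs_self c']
    · refine le_trans ?_ le_add_self
      refine le_trans ?_ le_add_self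
      rw [Set.indicator_of_mem (show ω ∈ {ω | partialSum ω j ∈ {b | Typical m ε τ j b} ∧
        (ω j).2 ∉ A j (partialSum ω j)} from ⟨hT, hh⟩)]
      exact hle1
  · rw [not_le] at hlev
    refine (hle.trans (abs_sub_le_of_window ε f hm hω j (hG j hj) hW)).trans ?_
    rw [add_assoc, roundChange]
    refine add_le_add (mul_le_mul_left (ENNReal.ofReal_le_ofReal ?_) _) le_self_add
    have h1 : τ * L ^ 3 ≤ √(m : ℝ) := by
      rw [div_mul_eq_mul_div, div_lt_one (Real.sqrt_pos.2 hm')] at hτL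
      exact hτL.le
    -- Here `ℓ < τ² L³ = τ · (τ L³) ≤ τ √m`, so the trivial change in a round already has the
    -- required size.
    have h2 : (level j : ℝ) ≤ τ * √(m : ℝ) := by nlinarith
    rw [Real.sqrt_mul hm'.le]
    calc 132 * (level j : ℝ) * √L ≤ 132 * (τ * √(m : ℝ)) * √L := by gcongr
      _ = 132 * τ * (√(m : ℝ) * √L) := by ring
      _ ≤ (132 + |c'|) * τ * (√(m : ℝ) * √L) := by
          gcongr
          linarith [abs_nonneg c']

end Gain

/-- With `y = m^(1/8)`, the logarithm is eventually below a small multiple of `m^(1/16) = √y`. At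
levels below `y` at most `y³` coins remain, so the width is at most `8y² ≤ y⁴ = √m`. The threshold
`6561 = 3⁸` ensures `y ≥ 3`. -/
theorem exists_large :
    ∃ M : ℕ, ∀ m : ℕ, M ≤ m → 49 ≤ m ∧ Real.logb 2 m ≤ m ∧
      25000 * Real.logb 2 m ≤ √(⌊(m : ℝ) ^ (1 / 8 : ℝ)⌋₊ : ℝ) ∧
      ∀ ℓ : ℕ, ℓ < ⌊(m : ℝ) ^ (1 / 8 : ℝ)⌋₊ → 8 * √(Real.logb 2 m * rem ℓ) ≤ √m := by
  have hlog : ∀ᶠ x : ℝ in Filter.atTop, Real.log x ≤ (Real.log 2 / 50000) * x ^ (1 / 16 : ℝ) := by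
    have h := (isLittleO_log_rpow_atTop (show (0 : ℝ) < 1 / 16 by norm_num)).def
      (show 0 < Real.log 2 / 50000 by positivity)
    filter_upwards [h, Filter.eventually_ge_atTop 1] with x hx hx1
    rw [Real.norm_of_nonneg (Real.log_nonneg hx1),
      Real.norm_of_nonneg (Real.rpow_nonneg (by linarith) _)] at hx
    exact hx
  have h2 := (hlog.and (Filter.eventually_ge_atTop (6561 : ℝ))).natCast_atTop
  obtain ⟨M, hM⟩ := Filter.eventually_atTop.1 h2
  refine ⟨M, fun m hm => ?_⟩
  obtain ⟨h1, h6561⟩ := hM m hm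
  have hm0 : (0 : ℝ) ≤ m := by positivity
  set y := (m : ℝ) ^ (1 / 8 : ℝ) with hy
  have hy8 : y ^ 8 = m := by
    rw [hy, ← Real.rpow_natCast, ← Real.rpow_mul hm0]; norm_num
  have hy0 : 0 ≤ y := Real.rpow_nonneg hm0 _
  have hysq : (m : ℝ) ^ (1 / 16 : ℝ) = √y := by
    rw [hy, Real.sqrt_eq_rpow, ← Real.rpow_mul hm0]; norm_num
  have hy3 : 3 ≤ y := by
    refine le_of_pow_le_pow_left₀ (n := 8) (by norm_num) hy0 ?_
    rw [hy8]; linarith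
  rw [hysq] at h1
  have hL : 50000 * Real.logb 2 m ≤ √y := by
    have hl2 : 0 < Real.log 2 := Real.log_pos one_lt_two
    rw [← Real.log_div_log, mul_div_assoc', div_le_iff₀ hl2]
    linarith
  have hsy : √y ≤ y := by
    rw [Real.sqrt_le_iff]; exact ⟨hy0, by nlinarith⟩
  have hL0 : 0 ≤ Real.logb 2 m := Real.logb_nonneg one_lt_two (by linarith)
  have hLy : Real.logb 2 m ≤ y := by linarith
  refine ⟨?_, ?_, ?_, ?_⟩
  · have : (49 : ℝ) ≤ m := by linarith
    exact_mod_cast this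
  · refine hLy.trans ?_
    rw [← hy8]
    exact le_self_pow₀ (by linarith) (by norm_num)
  · have hfl : y / 4 ≤ (⌊y⌋₊ : ℝ) := by
      have := Nat.lt_floor_add_one y
      linarith
    have h4 : √y / 2 ≤ √(⌊y⌋₊ : ℝ) := by
      refine Real.le_sqrt_of_sq_le ?_
      rw [div_pow, Real.sq_sqrt hy0]
      linarith
    linarith
  · intro ℓ hℓ
    have hℓy : (ℓ : ℝ) ≤ y := by
      have h5 : (ℓ : ℝ) ≤ ⌊y⌋₊ := by exact_mod_cast hℓ.le
      exact h5.trans (Nat.floor_le hy0)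
    have hr : (rem ℓ : ℝ) ≤ y ^ 3 := by
      calc (rem ℓ : ℝ) ≤ (ℓ : ℝ) ^ 3 := by exact_mod_cast rem_le ℓ
        _ ≤ y ^ 3 := by gcongr
    have h5 : √(Real.logb 2 m * rem ℓ) ≤ y ^ 2 := by
      refine Real.sqrt_le_iff.2 ⟨by positivity, ?_⟩
      calc Real.logb 2 m * rem ℓ ≤ y * y ^ 3 := by gcongr
        _ = (y ^ 2) ^ 2 := by ring
    refine Real.le_sqrt_of_sq_le ?_
    refine le_of_le_of_eq ?_ hy8
    calc (8 * √(Real.logb 2 m * rem ℓ)) ^ 2 ≤ (8 * y ^ 2) ^ 2 := by gcongr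
      _ = 64 * y ^ 4 := by ring
      _ ≤ y ^ 4 * y ^ 4 := by
          gcongr
          calc (64 : ℝ) ≤ 3 ^ 4 := by norm_num
            _ ≤ y ^ 4 := by gcongr
      _ = y ^ 8 := by ring

/-! ### Large and small numbers of rounds. -/

section Main

variable {H : Type*} {m : ℕ} (ε : Set.Icc (-1 : ℝ) 1) (f : ℕ → ℤ → ℤ → PMF H)

/-- For large `m`, the expectation of `gainBound` over the stopping round is small. -/
theorem sum_eexp_gainBound_le_ofReal {M : ℕ}
    (hM : ∀ m : ℕ, M ≤ m → 49 ≤ m ∧ Real.logb 2 m ≤ m ∧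
      25000 * Real.logb 2 m ≤ √(⌊(m : ℝ) ^ (1 / 8 : ℝ)⌋₊ : ℝ) ∧
      ∀ ℓ : ℕ, ℓ < ⌊(m : ℝ) ^ (1 / 8 : ℝ)⌋₊ → 8 * √(Real.logb 2 m * rem ℓ) ≤ √m)
    (hMm : M ≤ m) (hm : Odd (rem m)) (hε : |(ε : ℝ)| < 4 * √(Real.logb 2 m / rem m)) {τ c' : ℝ}
    (hτ : 1 ≤ τ) (hτL : τ / √(m : ℝ) * Real.logb 2 m ^ 3 < 1) {A : Fin m → ℤ → Set H}
    (hmass : ∀ j b, Typical m ε τ j b → ∑' h : ((A j b)ᶜ : Set H),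
      condProb (game m ε f) (withHint j b (h : H)) (noHint j b) ≤ 1 / (m : ℝ) ^ 2)
    {γ : Fin m → ℤ → H → ℝ} (hγ : ∀ j b h, γ j b h ≤ |cVal m ε f j b - vVal m ε f j b h|)
    (hA : ∀ j b, Typical m ε τ j b → ∀ h ∈ A j b, γ j b h ≤ changeBound m ε f τ c' j b)
    (B : Player H) :
    ∃ U : (Fin m → ℤ × H) → Fin m → ℝ≥0∞,
      (∀ ω, game m ε f ω ≠ 0 → ∀ j, ENNReal.ofReal (γ j (partialSum ω j) (ω j).2) ≤ U ω j) ∧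
      ∑ j, eexp (game m ε f) (fun ω => stopProb B ω j * U ω j) ≤
        ENNReal.ofReal ((31 + 22 * (132 + |c'|)) * (τ * √(Real.logb 2 m) / m)) := by
  obtain ⟨h49, hLm, hLt, hw⟩ := hM m hMm
  have hm' : (49 : ℝ) ≤ m := by exact_mod_cast h49
  set L := Real.logb 2 m with hLdef
  set t := ⌊(m : ℝ) ^ (1 / 8 : ℝ)⌋₊ with ht
  have hL : 1 ≤ L := by
    rw [hLdef, Real.le_logb_iff_rpow_le one_lt_two (by linarith), Real.rpow_one]
    linarith
  -- The binary logarithm dominates the natural one, so the tail is even at most `m^(-8)`.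
  have hexp : Real.exp (-8 * L) ≤ 1 / (m : ℝ) ^ 3 := by
    have hl2 : 0 < Real.log 2 := Real.log_pos one_lt_two
    have hlog0 : 0 ≤ Real.log m := Real.log_nonneg (by linarith)
    have h1 : Real.log m ≤ L := by
      rw [hLdef, ← Real.log_div_log, le_div_iff₀ hl2]
      nlinarith [Real.log_two_lt_d9]
    calc Real.exp (-8 * L) ≤ Real.exp (-(Real.log ((m : ℝ) ^ 3))) := by
          gcongr
          rw [Real.log_pow]
          push_cast
          linarith
      _ = 1 / (m : ℝ) ^ 3 := by rw [Real.exp_neg, Real.exp_log (by positivity), one_div]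
  have hG : ∀ j : Fin m, t ≤ level j → GoodLevel ε L (level j - 1) := by
    intro j hj
    have h0 : 0 < level j := Nat.sub_pos_of_lt j.2
    refine ⟨hL, ?_, ?_⟩
    · rw [level_pos j]
      exact abs_bias_le ε h0 (Nat.sub_le _ _) (by linarith) hε
    · rw [level_pos j]
      exact hLt.trans (Real.sqrt_le_sqrt (by exact_mod_cast hj))
  refine ⟨_, fun ω hω j => ofReal_le_gainBound ε f hLdef hL hτ hτL (by omega) hm ht hG hγ hA hω j,
    ?_⟩
  refine (sum_eexp_gainBound_le ε f B hL hm hG (w := √m) (fun j hj => hw _ hj)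
    (fun j => eexp_badHint_le ε f (hmass j))).trans ?_
  exact total_le ε hL hLm h49 hexp hm hε hτ (by positivity)

/-- No coins at all is an even number, and for `m = 1` the logarithm vanishes, so `|ε| < 0` would
follow. -/
theorem two_le_of_odd (hm : Odd (rem m)) (hε : |(ε : ℝ)| < 4 * √(Real.logb 2 m / rem m)) :
    2 ≤ m := by
  rcases m with _ | _ | m
  · simp [rem] at hm
  · simp at hε
    exact absurd hε (not_lt.2 (abs_nonneg _))
  · omega

theorem one_le_mul_of_le {τ : ℝ} {M : ℕ} (hm : 2 ≤ m) (hmM : m ≤ M) (hτ : 1 ≤ τ) {C : ℝ}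
    (hC : (M : ℝ) ≤ C) : 1 ≤ C * (τ * √(Real.logb 2 m) / m) := by
  have hm' : (2 : ℝ) ≤ m := by exact_mod_cast hm
  have hmM' : (m : ℝ) ≤ M := by exact_mod_cast hmM
  have hL : 1 ≤ √(Real.logb 2 m) := by
    rw [Real.one_le_sqrt, Real.le_logb_iff_rpow_le one_lt_two (by linarith), Real.rpow_one]
    exact hm'
  have h1 : 1 ≤ τ * √(Real.logb 2 m) := by nlinarith
  rw [mul_div_assoc', le_div_iff₀ (by linarith)]
  nlinarith

end Main

end BinomialGame

theorem mainTheorem7 (c' c'' : ℝ) :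
    ∃ C : ℝ, 0 < C ∧
      ∀ (H : Type*) (m : ℕ) (ε : Set.Icc (-1 : ℝ) 1) (f : ℕ → ℤ → ℤ → PMF H) (τ : ℝ),
        Odd (BinomialGame.rem m) →
        |(ε : ℝ)| < 4 * √(Real.logb 2 m / BinomialGame.rem m) →
        1 ≤ τ → τ ≤ m → τ / √(m : ℝ) * Real.logb 2 m ^ 3 < 1 →
        -- hints that lower the value by little: nobody gains much by betting on a decrease
        ((∀ (j : Fin m) (b : ℤ), BinomialGame.Typical m ε τ j b →
            ∃ A : Set H, BinomialGame.GoodHints m ε f τ c' c'' j b A) →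
          ∀ B : BinomialGame.Player H,
            BinomialGame.signedBias m ε f B ≤ C * (τ * √(Real.logb 2 m) / m)) ∧
        -- hints that change the value by little: the bias of the game is small
        ((∀ (j : Fin m) (b : ℤ), BinomialGame.Typical m ε τ j b →
            ∃ A : Set H, BinomialGame.GoodHints m ε f τ c' c'' j b A ∧
              ∀ h ∈ A, |BinomialGame.cVal m ε f j b - BinomialGame.vVal m ε f j b h| ≤
                BinomialGame.changeBound m ε f τ c' j b) →
          BinomialGame.bias m ε f ≤ C * (τ * √(Real.logb 2 m) / m)) := by
  obtain ⟨M, hM⟩ := BinomialGame.exists_large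
  have hc := abs_nonneg c'
  have hM0 : (0 : ℝ) ≤ M := by positivity
  -- The summand `M` makes the bound at least 1, hence trivial, for `m ≤ M`.
  refine ⟨31 + 22 * (132 + |c'|) + M, by linarith, ?_⟩
  intro H m ε f τ hm hε hτ _ hτL
  have hnn : 0 ≤ τ * √(Real.logb 2 m) / m := by positivity
  have hm2 := BinomialGame.two_le_of_odd ε hm hε
  rcases le_total m M with hmM | hMm
  · have h1 := BinomialGame.one_le_mul_of_le (C := 31 + 22 * (132 + |c'|) + M) hm2 hmM hτ
      (by linarith)
    refine ⟨fun _ B => ?_, fun _ => ?_⟩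
    · exact ((le_abs_self _).trans (BinomialGame.abs_signedBias_le_one m ε f B)).trans h1
    · have : Nonempty (BinomialGame.Player H) := ⟨fun _ => PMF.pure true⟩
      exact (ciSup_le fun B => BinomialGame.abs_signedBias_le_one m ε f B).trans h1
  · have hle : (31 + 22 * (132 + |c'|)) * (τ * √(Real.logb 2 m) / m) ≤
        (31 + 22 * (132 + |c'|) + M) * (τ * √(Real.logb 2 m) / m) := by
      exact mul_le_mul_of_nonneg_right (by linarith) hnn
    have hK : 0 ≤ (31 + 22 * (132 + |c'|)) * (τ * √(Real.logb 2 m) / m) := by positivity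
    have part1 : (∀ (j : Fin m) (b : ℤ), BinomialGame.Typical m ε τ j b →
        ∃ A : Set H, BinomialGame.GoodHints m ε f τ c' c'' j b A) →
          ∀ B : BinomialGame.Player H, BinomialGame.signedBias m ε f B ≤
            (31 + 22 * (132 + |c'|)) * (τ * √(Real.logb 2 m) / m) := by
      intro hyp B
      choose! A hA using hyp
      obtain ⟨U, hU1, hU2⟩ := BinomialGame.sum_eexp_gainBound_le_ofReal ε f hM hMm hm hε hτ hτL
        (fun j b hT => (hA j b hT).mass)
        (γ := fun j b h => BinomialGame.cVal m ε f j b - BinomialGame.vVal m ε f j b h)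
        (fun _ _ _ => le_abs_self _) (fun j b hT => (hA j b hT).change) B
      exact BinomialGame.signedBias_le ε f B hK U hU1 hU2
    refine ⟨fun hyp B => (part1 hyp B).trans hle, fun hyp => ?_⟩
    have : Nonempty (BinomialGame.Player H) := ⟨fun _ => PMF.pure true⟩
    refine ciSup_le fun B => (abs_le'.2 ⟨?_, ?_⟩).trans hle
    · exact part1 (fun j b hT => (hyp j b hT).imp fun _ h => h.1) B
    · choose! A hA using hyp
      obtain ⟨U, hU1, hU2⟩ := BinomialGame.sum_eexp_gainBound_le_ofReal ε f hM hMm hm hε hτ hτL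
        (fun j b hT => (hA j b hT).1.mass)
        -- The two-sided hypothesis also bounds the gain from betting on an increase.
        (γ := fun j b h => -(BinomialGame.cVal m ε f j b - BinomialGame.vVal m ε f j b h))
        (fun _ _ _ => neg_le_abs _)
        (fun j b hT h hh => (neg_le_abs _).trans ((hA j b hT).2 h hh)) B
      exact BinomialGame.neg_signedBias_le ε f B hK U hU1 hU2
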